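/- Let $N$ be a smooth $n$-dimensional manifold, $n=n^++n^-$, let $p_M\colon M\to N$ be the bundle of pseudo-Riemannian metrics on $N$ of signature $(n^+,n^-)$ and $p_C\colon C\to N$ the bundle of linear connections on $N$ (an affine bundle modelled on $\otimes^2T^*N\otimes TN$; its points over $x$ are the values $\Gamma_x$ at $x$ of linear connections). An Ehresmann connection on a fibred manifold $p\colon P\to N$ is a smooth bundle homomorphism $\gamma\colon TP\to V(p)=\ker p_*$ with $\gamma(X)=X$ for all $X\in V(p)$. Let $\gamma$ be an Ehresmann connection on $M\times_NC\to N$ whose component $\gamma_C$ is defined on $C$, i.e., $\gamma_C$ is an Ehresmann connection on $C\to N$ such that $\mathrm{pr}_{2*}(\gamma(X))=\gamma_C(\mathrm{pr}_{2*}X)$ for all $X\in T(M\times_NC)$. *Notation.* Via $V(p_C)\cong (p_C)^*(\otimes^2T^*N\otimes TN)$ (the velocity of $t\mapsto\Gamma_x+tB$ at $t=0$ corresponds to $B$), $\gamma_C$ is viewed as a homomorphism $TC\to\otimes^2T^*N\otimes TN$. Define $$\tilde\gamma_C(X,Y)=c^1_1\big((p_C)_*Y\otimes\gamma_C(X)\big)-c^1_1\big((p_C)_*X\otimes\gamma_C(Y)\big),\qquad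 X,Y\in T_{\Gamma_x}C,$$ with $c^1_1(X_1\otimes w_1\otimes w_2\otimes X_2)=w_1(X_1)\,w_2\otimes X_2$. Let $\mathrm{alt}_{12}$ be the alternation of the two covariant arguments, $(\mathrm{alt}_{12}B)(v,w)=B(v,w)-B(w,v)$. Let $\tau_N(\Gamma_x)=T^{\Gamma_x}$ be the section of $(p_C)^*(\wedge^2T^*N\otimes TN)$ given by the torsion $T(X,Y)=\nabla_XY-\nabla_YX-[X,Y]$. For a tensor bundle $E\to N$ let $\nabla^E$ be the canonical covariant derivative on $(p_C)^*E$, determined by $$\big(\nabla^E_X(f\xi)\big)(\Gamma_x)=(Xf)\,\xi(x)+f(\Gamma_x)\,\big(\nabla^{\Gamma_x}_{(p_C)_*X}\xi\big)(x),\qquad X\in T_{\Gamma_x}C,\ f\in C^\infty(C),\ \xi \text{ a local section of } E;$$ write $\nabla^{(1)}=\nabla^{TN}$ and $\nabla^{(2)}=\nabla^{\wedge^2T^*N\otimes TN}$, and let $R^{\nabla^{(1)}}(X,Y)=[\nabla^{(1)}_X,\nabla^{(1)}_Y]-\nabla^{(1)}_{[X,Y]}$. Given a coordinate system $(U;x^1,\dots,x^n)$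 of $N$, let $(x^i,A^i_{jk})$ be the induced coordinates on $p_C^{-1}(U)$, where $\nabla^{\Gamma}_{\partial/\partial x^j}\,\partial/\partial x^k=A^i_{jk}(\Gamma)\,\partial/\partial x^i$, and write $\gamma_C=(dA^i_{jk}+\gamma^i_{jkl}\,dx^l)\otimes\partial/\partial A^i_{jk}$ there (summation over repeated indices). **Proposition.** In every coordinate system of $N$ and at every point of $p_C^{-1}(U)$ (hence also on $p_C^{-1}(U)$ as a whole), the equation $$\tilde\gamma_C=R^{\nabla^{(1)}}$$ is equivalent to $$\gamma^h_{str}-\gamma^h_{rts}=A^h_{rm}A^m_{st}-A^h_{sm}A^m_{rt}\qquad\text{for all }h,r,s,t, \tag{28}$$ and the equation $$\mathrm{alt}_{12}\circ\gamma_C=\nabla^{(2)}\tau_N$$ is equivalent to $$\gamma^h_{rst}-\gamma^h_{srt}=A^h_{tm}(A^m_{rs}-A^m_{sr})+A^m_{ts}(A^h_{mr}-A^h_{rm})+A^m_{tr}(A^h_{sm}-A^h_{ms})\qquad\text{for all }h,r,s,t. \tag{29}$$ In particular, the two geometric equations together are equivalent to (28) and (29) together. -/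

import Mathlib

open Set Filter Topology Bundle Manifold
open scoped ContDiff

set_option linter.unusedSectionVars false

namespace ConnBdl

noncomputable section

abbrev Eu (n : ℕ) : Type := EuclideanSpace ℝ (Fin n)

theorem two_le_infty : (2 : WithTop ℕ∞) ≤ ∞ := by
  exact WithTop.coe_le_coe.2 (le_top : (2 : ℕ∞) ≤ ⊤)

section Coordinates

variable {n : ℕ} {N : Type*} [TopologicalSpace N] [ChartedSpace (Eu n) N]

/-- A coordinate system `(x¹,…,xⁿ)` on the open set `φ.source`: a chart of the maximal smooth atlas. -/
abbrev IsCoord (φ : OpenPartialHomeomorph N (Eu n)) : Prop :=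
  φ ∈ IsManifold.maximalAtlas (𝓡 n) ∞ N

/-- The coordinate differential `dxⁱ` at `x`. -/
def dx (φ : OpenPartialHomeomorph N (Eu n)) (i : Fin n) (x : N) : TangentSpace (𝓡 n) x →L[ℝ] ℝ :=
  (EuclideanSpace.proj i : Eu n →L[ℝ] ℝ) ∘L (mvfderiv (𝓡 n) (φ : N → Eu n) x)

/-- The coordinate vector field `∂/∂xᵏ` (only meaningful on `φ.source`). -/
def coordField (φ : OpenPartialHomeomorph N (Eu n)) (k : Fin n) (x : N) : TangentSpace (𝓡 n) x :=
  (mvfderiv (𝓡 n) (φ : N → Eu n) x).inverse (EuclideanSpace.single k (1 : ℝ))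

variable {φ ψ : OpenPartialHomeomorph N (Eu n)} {x : N}

theorem IsCoord.one (hφ : IsCoord φ) : φ ∈ IsManifold.maximalAtlas (𝓡 n) 1 N :=
  IsManifold.maximalAtlas_subset_of_le (by simp) hφ

theorem mvfderiv_of_const {f : N → ℝ} {c : ℝ} (h : f =ᶠ[𝓝 x] fun _ => c) :
    mvfderiv (𝓡 n) f x = 0 := by
  rw [mvfderiv, h.mfderiv_eq, mfderiv_const]
  exact ContinuousLinearMap.comp_zero _

theorem IsCoord.mdiff (hφ : IsCoord φ) : φ.MDifferentiable (𝓡 n) (𝓡 n) :=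
  ⟨fun _ h => (mdifferentiableAt_of_mem_maximalAtlas hφ.one h).mdifferentiableWithinAt,
    fun _ h => (mdifferentiableAt_symm_of_mem_maximalAtlas hφ.one h).mdifferentiableWithinAt⟩

theorem IsCoord.invertible (hφ : IsCoord φ) (hx : x ∈ φ.source) :
    (mvfderiv (𝓡 n) (φ : N → Eu n) x).IsInvertible :=
  ⟨hφ.mdiff.mfderiv hx, rfl⟩

theorem dx_coordField (hφ : IsCoord φ) (hx : x ∈ φ.source) (i k : Fin n) :
    dx φ i x (coordField φ k x) = if i = k then 1 else 0 := by
  obtain ⟨e, he⟩ := hφ.invertible hx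
  simp [dx, coordField, ← he]

theorem coord_decomp (hφ : IsCoord φ) (hx : x ∈ φ.source) (v : TangentSpace (𝓡 n) x) :
    v = ∑ k, dx φ k x v • coordField φ k x := by
  obtain ⟨e, he⟩ := hφ.invertible hx
  apply e.injective
  rw [map_sum]
  ext i
  simp [dx, coordField, ← he, Finset.sum_apply, Pi.single_apply]

theorem coord_ext (hφ : IsCoord φ) (hx : x ∈ φ.source) {v w : TangentSpace (𝓡 n) x}
    (h : ∀ i, dx φ i x v = dx φ i x w) : v = w := by
  rw [coord_decomp hφ hx v, coord_decomp hφ hx w]; simp [h]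

variable [IsManifold (𝓡 n) ∞ N]

/-- The vector field `σ` is differentiable at `x`. -/
abbrev DiffSec (σ : Π y : N, TangentSpace (𝓡 n) y) (x : N) : Prop :=
  MDifferentiableAt (𝓡 n) (𝓡 n).tangent (fun y => (⟨y, σ y⟩ : TangentBundle (𝓡 n) N)) x

theorem mdiff_coordField (hφ : IsCoord φ) (hx : x ∈ φ.source) (k : Fin n) :
    DiffSec (coordField φ k) x := by
  have : IsManifold (𝓡 n) 2 N := IsManifold.of_le (n := ∞) two_le_infty
  have := MDifferentiableAt.mpullback_vectorField (I := 𝓡 n) (I' := 𝓡 n) (f := φ) (x₀ := x) (n := 2)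
    (V := fun _ => (EuclideanSpace.single k (1 : ℝ) : Eu n)) ?_ ?_ ?_ le_rfl
  · exact this
  · exact ((contMDiffAt_vectorSpace_iff_contDiffAt (n := 1)).2 contDiffAt_const).mdifferentiableAt
      one_ne_zero
  · exact (contMDiffAt_of_mem_maximalAtlas hφ hx).of_le two_le_infty
  · exact hφ.invertible hx

theorem mdiff_dx (hφ : IsCoord φ) (hx : x ∈ φ.source) (k : Fin n) {σ : Π y : N, TangentSpace (𝓡 n) y}
    (hσ : DiffSec σ x) :
    MDifferentiableAt (𝓡 n) 𝓘(ℝ, ℝ) (fun y => dx φ k y (σ y)) x := by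
  have h1 : ContMDiffOn (𝓡 n).tangent (𝓡 n).tangent 1 (tangentMapWithin (𝓡 n) (𝓡 n) φ φ.source)
      (π (Eu n) (TangentSpace (𝓡 n)) ⁻¹' φ.source) :=
    (contMDiffOn_of_mem_maximalAtlas hφ).contMDiffOn_tangentMapWithin (by rw [one_add_one_eq_two]; exact two_le_infty)
      φ.open_source.uniqueMDiffOn
  have h2 : MDifferentiableAt (𝓡 n).tangent (𝓡 n).tangent
      (tangentMapWithin (𝓡 n) (𝓡 n) φ φ.source) (⟨x, σ x⟩ : TangentBundle (𝓡 n) N) := by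
    refine ((h1 _ hx).contMDiffAt ?_).mdifferentiableAt one_ne_zero
    exact (φ.open_source.preimage (FiberBundle.continuous_proj _ _)).mem_nhds hx
  have h3 := (contMDiff_snd_tangentBundle_modelSpace (Eu n) (𝓡 n) (n := 1)).mdifferentiable one_ne_zero
  have h4 := (h3 _).comp x (h2.comp x hσ)
  have h5 : MDifferentiableAt (𝓡 n) 𝓘(ℝ, ℝ) ((EuclideanSpace.proj k : Eu n →L[ℝ] ℝ) ∘ _) x :=
    ((EuclideanSpace.proj k : Eu n →L[ℝ] ℝ).contMDiff.mdifferentiable one_ne_zero _).comp x h4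
  refine h5.congr_of_eventuallyEq ?_
  filter_upwards [φ.open_source.mem_nhds hx] with y hy
  simp only [Function.comp, tangentMapWithin, mfderivWithin_of_isOpen φ.open_source hy]
  rfl


variable (n) in
/-- The value at `x` of a linear connection on `N` (an element of the fibre `C_x`): the operator
`ξ ↦ (v ↦ ∇_v ξ)`, defined on the vector fields differentiable at `x`, additive and satisfying the
Leibniz rule.  On vector fields that are not differentiable at `x` it carries no information and is
normalised to be `0`. -/
@[ext]
structure LinConnAt (x : N) where
  toFun : (Π y : N, TangentSpace (𝓡 n) y) → TangentSpace (𝓡 n) x →L[ℝ] TangentSpace (𝓡 n) x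
  add : ∀ {σ τ}, DiffSec σ x → DiffSec τ x → toFun (σ + τ) = toFun σ + toFun τ
  leibniz : ∀ {f : N → ℝ} {σ}, MDifferentiableAt (𝓡 n) 𝓘(ℝ, ℝ) f x → DiffSec σ x →
    toFun (f • σ) = f x • toFun σ + (mvfderiv (𝓡 n) f x).smulRight (σ x)
  junk : ∀ {σ}, ¬ DiffSec σ x → toFun σ = 0

theorem LinConnAt.congr (Γ : LinConnAt n x) {σ τ : Π y : N, TangentSpace (𝓡 n) y}
    (hσ : DiffSec σ x) (hτ : DiffSec τ x) (h : ∀ᶠ y in 𝓝 x, σ y = τ y) :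
    Γ.toFun σ = Γ.toFun τ := by
  classical
  let f : N → ℝ := fun y => if σ y = τ y then 1 else 0
  have hf1 : f =ᶠ[𝓝 x] fun _ => 1 := h.mono fun y hy => by simp [f, hy]
  have hfd : MDifferentiableAt (𝓡 n) 𝓘(ℝ, ℝ) f x := mdifferentiableAt_const.congr_of_eventuallyEq hf1
  have hf0 : mvfderiv (𝓡 n) f x = 0 := mvfderiv_of_const hf1
  have hfx : f x = 1 := hf1.self_of_nhds
  have key : f • σ = f • τ := by
    funext y
    by_cases hy : σ y = τ y <;> simp [f, hy]
  have h1 := Γ.leibniz hfd hσ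
  have h2 := Γ.leibniz hfd hτ
  rw [key, h2] at h1
  simpa [hf0, hfx] using h1.symm

theorem LinConnAt.expand (Γ : LinConnAt n x) (hφ : IsCoord φ) (hx : x ∈ φ.source)
    {σ : Π y : N, TangentSpace (𝓡 n) y} (hσ : DiffSec σ x) :
    Γ.toFun σ = ∑ k, (dx φ k x (σ x) • Γ.toFun (coordField φ k) +
      (mvfderiv (𝓡 n) (fun y => dx φ k y (σ y)) x).smulRight (coordField φ k x)) := by
  have hk : ∀ k, DiffSec ((fun y => dx φ k y (σ y)) • coordField φ k) x := fun k =>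
    MDifferentiableAt.smul_section (mdiff_dx hφ hx k hσ) (mdiff_coordField hφ hx k)
  have h0 : Γ.toFun 0 = 0 := by
    have h := Γ.add (σ := 0) (τ := 0) (mdifferentiableAt_zeroSection ..) (mdifferentiableAt_zeroSection ..)
    simpa using h
  have hsum : ∀ s : Finset (Fin n), DiffSec (∑ k ∈ s, (fun y => dx φ k y (σ y)) • coordField φ k) x ∧
      Γ.toFun (∑ k ∈ s, (fun y => dx φ k y (σ y)) • coordField φ k) =
      ∑ k ∈ s, Γ.toFun ((fun y => dx φ k y (σ y)) • coordField φ k) := by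
    intro s
    induction s using Finset.induction_on with
    | empty => exact ⟨mdifferentiableAt_zeroSection .., by simpa using h0⟩
    | insert a s ha ih =>
      rw [Finset.sum_insert ha, Finset.sum_insert ha, Γ.add (hk a) ih.1, ih.2]
      exact ⟨mdifferentiableAt_add_section (hk a) ih.1, rfl⟩
  rw [Γ.congr hσ (hsum Finset.univ).1, (hsum Finset.univ).2]
  · refine Finset.sum_congr rfl fun k _ => ?_
    exact Γ.leibniz (mdiff_dx hφ hx k hσ) (mdiff_coordField hφ hx k)
  · filter_upwards [φ.open_source.mem_nhds hx] with y hy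
    rw [Finset.sum_apply]
    exact coord_decomp hφ hy (σ y)

/-- Arrays `A j k i`, standing for Christoffel symbols `Aⁱ_{jk}`. -/
abbrev Arr (n : ℕ) : Type := Fin n → Fin n → Fin n → ℝ

/-- The Christoffel symbols of `Γ` in the coordinate system `φ`:
`∇_{∂/∂xʲ} ∂/∂xᵏ = Aⁱ_{jk} ∂/∂xⁱ`. -/
def christoffel (φ : OpenPartialHomeomorph N (Eu n)) {x : N} (Γ : LinConnAt n x) : Arr n :=
  fun j k i => dx φ i x (Γ.toFun (coordField φ k) (coordField φ j x))

theorem christoffel_injective (hφ : IsCoord φ) (hx : x ∈ φ.source) :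
    Function.Injective (christoffel φ : LinConnAt n x → Arr n) := by
  intro Γ Γ' h
  ext1
  funext σ
  by_cases hσ : DiffSec σ x
  · rw [Γ.expand hφ hx hσ, Γ'.expand hφ hx hσ]
    refine Finset.sum_congr rfl fun k _ => ?_
    congr 2
    ext1 v
    rw [coord_decomp hφ hx v]
    simp only [map_sum, map_smul]
    refine Finset.sum_congr rfl fun j _ => ?_
    congr 1
    exact coord_ext hφ hx fun i => congrFun (congrFun (congrFun h j) k) i
  · rw [Γ.junk hσ, Γ'.junk hσ]

/-- The linear connection at `x` with given Christoffel symbols. -/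
def ofChristoffel (hφ : IsCoord φ) (hx : x ∈ φ.source) (A : Arr n) : LinConnAt n x := by
  classical exact
  { toFun := fun σ => if DiffSec σ x then
      ∑ i, (mvfderiv (𝓡 n) (fun y => dx φ i y (σ y)) x +
        ∑ j, ∑ k, (A j k i * dx φ k x (σ x)) • dx φ j x).smulRight (coordField φ i x) else 0
    add := by
      intro σ τ hσ hτ
      rw [if_pos hσ, if_pos hτ, if_pos (mdifferentiableAt_add_section hσ hτ), ← Finset.sum_add_distrib]
      refine Finset.sum_congr rfl fun i _ => ?_
      have : (fun y => dx φ i y ((σ + τ) y)) = (fun y => dx φ i y (σ y)) + fun y => dx φ i y (τ y) := by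
        funext y; simp
      rw [this, mvfderiv_add (mdiff_dx hφ hx i hσ) (mdiff_dx hφ hx i hτ)]
      ext1 v
      simp [mul_add, add_mul, Finset.sum_add_distrib, ← add_smul]
      congr 1
      ring
    leibniz := by
      intro f σ hf hσ
      rw [if_pos hσ, if_pos (MDifferentiableAt.smul_section hf hσ)]
      have : ∀ i, (fun y => dx φ i y ((f • σ) y)) = f * (fun y => dx φ i y (σ y)) := by
        intro i; funext y; simp
      ext1 v
      simp only [this, mvfderiv_mul hf (mdiff_dx hφ hx _ hσ)]
      apply coord_ext hφ hx
      intro l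
      have hs : ∑ j, ∑ k, A j k l * (f x * dx φ k x (σ x)) * dx φ j x v =
          f x * ∑ j, ∑ k, A j k l * dx φ k x (σ x) * dx φ j x v := by
        simp only [Finset.mul_sum]
        exact Finset.sum_congr rfl fun j _ => Finset.sum_congr rfl fun k _ => by ring
      simp [dx_coordField hφ hx, hs]
      ring
    junk := fun h => if_neg h }

theorem christoffel_ofChristoffel (hφ : IsCoord φ) (hx : x ∈ φ.source) (A : Arr n) :
    christoffel φ (ofChristoffel hφ hx A) = A := by
  funext j k i
  have h : ∀ l, mvfderiv (𝓡 n) (fun y => dx φ l y (coordField φ k y)) x = 0 := by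
    intro l
    have : (fun y => dx φ l y (coordField φ k y)) =ᶠ[𝓝 x] fun _ => if l = k then (1:ℝ) else 0 := by
      filter_upwards [φ.open_source.mem_nhds hx] with y hy
      exact dx_coordField hφ hy l k
    exact mvfderiv_of_const this
  simp [christoffel, ofChristoffel, mdiff_coordField hφ hx k, h, dx_coordField hφ hx]


theorem IsCoord.contDiffOn_change (hφ : IsCoord φ) (hψ : IsCoord ψ) :
    ContDiffOn ℝ ∞ (ψ ∘ φ.symm) (φ.symm ≫ₕ ψ).source := by
  rw [← contMDiffOn_iff_contDiffOn]
  have h1 := contMDiffOn_of_mem_maximalAtlas hψ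
  have h2 := contMDiffOn_symm_of_mem_maximalAtlas hφ
  exact h1.comp (h2.mono fun u hu => hu.1) fun u hu => hu.2

theorem dx_coordField_change (hφ : IsCoord φ) (hψ : IsCoord ψ) (hx : x ∈ φ.source)
    (hx' : x ∈ ψ.source) (a k : Fin n) :
    dx φ a x (coordField ψ k x) =
      fderiv ℝ (φ ∘ ψ.symm) (ψ x) (EuclideanSpace.single k (1 : ℝ)) a := by
  have hinv : coordField ψ k x = (hψ.mdiff.mfderiv hx').symm (EuclideanSpace.single k (1 : ℝ)) := by
    rw [coordField, (hψ.invertible hx').inverse_apply_eq]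
    exact ((hψ.mdiff.mfderiv hx').apply_symm_apply _).symm
  have h1 : MDifferentiableAt (𝓡 n) (𝓡 n) φ (ψ.symm (ψ x)) := by
    rw [ψ.left_inv hx']; exact hφ.mdiff.mdifferentiableAt hx
  have h2 := hψ.mdiff.mdifferentiableAt_symm (ψ.map_source hx')
  have h3 := mfderiv_comp (ψ x) h1 h2
  rw [mfderiv_eq_fderiv, ψ.left_inv hx'] at h3
  rw [h3, hinv]
  rfl

/-- The Jacobian entry `∂xᵃ/∂x'ᵏ` of a change of coordinates from `φ = (x)` to `ψ = (x')`, as a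
function of the coordinates `x`. -/
def jac (φ ψ : OpenPartialHomeomorph N (Eu n)) (a k : Fin n) (u : Eu n) : ℝ :=
  fderiv ℝ (φ ∘ ψ.symm) (ψ (φ.symm u)) (EuclideanSpace.single k (1 : ℝ)) a

/-- The Jacobian entry `∂x'ⁱ/∂xᶜ`, as a function of the coordinates `x`. -/
def jacInv (φ ψ : OpenPartialHomeomorph N (Eu n)) (i c : Fin n) (u : Eu n) : ℝ :=
  fderiv ℝ (ψ ∘ φ.symm) u (EuclideanSpace.single c (1 : ℝ)) i

theorem dx_coordField_jac (hφ : IsCoord φ) (hψ : IsCoord ψ) (hx : x ∈ φ.source)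
    (hx' : x ∈ ψ.source) (a k : Fin n) :
    dx φ a x (coordField ψ k x) = jac φ ψ a k (φ x) := by
  rw [dx_coordField_change hφ hψ hx hx', jac, φ.left_inv hx]

theorem dx_coordField_jacInv (hφ : IsCoord φ) (hψ : IsCoord ψ) (hx : x ∈ φ.source)
    (hx' : x ∈ ψ.source) (i c : Fin n) :
    dx ψ i x (coordField φ c x) = jacInv φ ψ i c (φ x) := by
  rw [dx_coordField_change hψ hφ hx' hx, jacInv]

theorem contDiffOn_jacInv (hφ : IsCoord φ) (hψ : IsCoord ψ) (i c : Fin n) :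
    ContDiffOn ℝ ∞ (jacInv φ ψ i c) (φ.symm ≫ₕ ψ).source := by
  have h := (hφ.contDiffOn_change hψ).fderiv_of_isOpen (m := ∞) (φ.symm ≫ₕ ψ).open_source (by simp)
  exact (EuclideanSpace.proj i : Eu n →L[ℝ] ℝ).contDiff.comp_contDiffOn
    (h.clm_apply contDiffOn_const)

theorem contDiffOn_jac (hφ : IsCoord φ) (hψ : IsCoord ψ) (a k : Fin n) :
    ContDiffOn ℝ ∞ (jac φ ψ a k) (φ.symm ≫ₕ ψ).source := by
  refine (contDiffOn_jacInv hψ hφ a k).comp (hφ.contDiffOn_change hψ) fun u hu => ?_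
  simp only [mfld_simps] at hu ⊢
  simp [hu]

/-- The transformation law of the Christoffel symbols under a change of coordinates. -/
def christoffelChange (φ ψ : OpenPartialHomeomorph N (Eu n)) (q : Eu n × Arr n) : Arr n :=
  fun j k i => ∑ a, (jac φ ψ a k q.1 * ∑ b, jac φ ψ b j q.1 * ∑ c, jacInv φ ψ i c q.1 * q.2 b a c +
    (∑ b, jac φ ψ b j q.1 * fderiv ℝ (jac φ ψ a k) q.1 (EuclideanSpace.single b (1 : ℝ))) *
      jacInv φ ψ i a q.1)

theorem contDiffOn_christoffelChange (hφ : IsCoord φ) (hψ : IsCoord ψ) :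
    ContDiffOn ℝ ∞ (christoffelChange φ ψ) ((φ.symm ≫ₕ ψ).source ×ˢ univ) := by
  have hfst : MapsTo (Prod.fst : Eu n × Arr n → Eu n) ((φ.symm ≫ₕ ψ).source ×ˢ univ)
    (φ.symm ≫ₕ ψ).source := fun q hq => hq.1
  have hJ := fun a k => (contDiffOn_jac hφ hψ a k).comp (contDiff_fst.contDiffOn) hfst
  have hK := fun a k => (contDiffOn_jacInv hφ hψ a k).comp (contDiff_fst.contDiffOn) hfst
  have hD := fun a k (b : Fin n) =>
    (((contDiffOn_jac hφ hψ a k).fderiv_of_isOpen (m := ∞) (φ.symm ≫ₕ ψ).open_source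
      (by simp)).clm_apply (contDiffOn_const (c := EuclideanSpace.single b (1 : ℝ)))).comp
      (contDiff_fst.contDiffOn) hfst
  have hA : ∀ b a c : Fin n, ContDiffOn ℝ ∞ (fun q : Eu n × Arr n => q.2 b a c)
    ((φ.symm ≫ₕ ψ).source ×ˢ univ) := fun b a c => by fun_prop
  refine contDiffOn_pi.2 fun j => contDiffOn_pi.2 fun k => contDiffOn_pi.2 fun i => ?_
  refine ContDiffOn.sum fun a _ => ContDiffOn.add ?_ ?_
  · refine (hJ a k).mul (ContDiffOn.sum fun b _ => (hJ b j).mul (ContDiffOn.sum fun c _ => ?_))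
    exact (hK i c).mul (hA b a c)
  · exact (ContDiffOn.sum fun b _ => (hJ b j).mul (hD a k b)).mul (hK i a)

theorem christoffel_change (hφ : IsCoord φ) (hψ : IsCoord ψ) (hx : x ∈ φ.source)
    (hx' : x ∈ ψ.source) (Γ : LinConnAt n x) :
    christoffel ψ Γ = christoffelChange φ ψ (φ x, christoffel φ Γ) := by
  have hsrc : φ x ∈ (φ.symm ≫ₕ ψ).source := by simp [hx, hx']
  have hd : ∀ a k b, mvfderiv (𝓡 n) (fun y => dx φ a y (coordField ψ k y)) x (coordField φ b x) =
      fderiv ℝ (jac φ ψ a k) (φ x) (EuclideanSpace.single b (1 : ℝ)) := by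
    intro a k b
    have heq : (fun y => dx φ a y (coordField ψ k y)) =ᶠ[𝓝 x] jac φ ψ a k ∘ φ := by
      filter_upwards [φ.open_source.mem_nhds hx, ψ.open_source.mem_nhds hx'] with y hy hy'
      exact dx_coordField_jac hφ hψ hy hy' a k
    have hdj : MDifferentiableAt (𝓡 n) 𝓘(ℝ, ℝ) (jac φ ψ a k) (φ x) :=
      (((contDiffOn_jac hφ hψ a k).contDiffAt ((φ.symm ≫ₕ ψ).open_source.mem_nhds hsrc)).differentiableAt
        (by simp)).mdifferentiableAt
    have hc := mvfderiv_comp_apply x hdj (hφ.mdiff.mdifferentiableAt hx) (coordField φ b x)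
    have h1 : mvfderiv (𝓡 n) (fun y => dx φ a y (coordField ψ k y)) x =
        mvfderiv (𝓡 n) (jac φ ψ a k ∘ φ) x := by
      ext1 v
      change mfderiv (𝓡 n) 𝓘(ℝ, ℝ) (fun y => dx φ a y (coordField ψ k y)) x v =
        mfderiv (𝓡 n) 𝓘(ℝ, ℝ) (jac φ ψ a k ∘ φ) x v
      rw [heq.mfderiv_eq]
      rfl
    rw [h1, hc]
    obtain ⟨e, he⟩ := hφ.invertible hx
    have h2 : mfderiv (𝓡 n) (𝓡 n) φ x (coordField φ b x) = EuclideanSpace.single b (1 : ℝ) := by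
      change mvfderiv (𝓡 n) (φ : N → Eu n) x (coordField φ b x) = _
      simp [coordField, ← he]
    rw [h2, mvfderiv, mfderiv_eq_fderiv]
    rfl
  funext j k i
  rw [christoffel, Γ.expand hφ hx (mdiff_coordField hψ hx' k), coord_decomp hφ hx (coordField ψ j x)]
  simp only [christoffelChange, map_sum, map_smul, sum_apply,
    add_apply, smul_apply,
    ContinuousLinearMap.smulRight_apply, dx_coordField_jac hφ hψ hx hx', hd, map_add, smul_eq_mul,
    dx_coordField_jacInv hφ hψ hx hx']
  have hS : ∀ a b, dx ψ i x (Γ.toFun (coordField φ a) (coordField φ b x)) =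
      ∑ c, jacInv φ ψ i c (φ x) * christoffel φ Γ b a c := by
    intro a b
    conv_lhs => rw [coord_decomp hφ hx (Γ.toFun (coordField φ a) (coordField φ b x))]
    simp only [map_sum, map_smul, smul_eq_mul, dx_coordField_jacInv hφ hψ hx hx']
    exact Finset.sum_congr rfl fun c _ => mul_comm _ _
  simp only [hS]
  simp only [Finset.mul_sum, Finset.sum_mul, mul_add, Finset.sum_add_distrib]
  congr 1
  · rw [Finset.sum_comm]
    refine Finset.sum_congr rfl fun a _ => Finset.sum_congr rfl fun b _ =>
      Finset.sum_congr rfl fun c _ => by ring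
  · rw [Finset.sum_comm]
    refine Finset.sum_congr rfl fun a _ => Finset.sum_congr rfl fun b _ => by ring


/-! ### Bundles over `N` given by natural fibre coordinates -/

/-- Natural fibre coordinates: for every coordinate system `φ` of `N` and every `x` in its domain, a
bijection `coord φ x` of the fibre `Fib x` onto a fixed open subset `dom` of a normed space `V`, such
that the coordinate changes are smooth. -/
structure FibreCoords (n : ℕ) (N : Type*) [TopologicalSpace N] [ChartedSpace (Eu n) N]
    (Fib : N → Type*) (V : Type*) [NormedAddCommGroup V] [NormedSpace ℝ V] where
  dom : Set V
  isOpen_dom : IsOpen dom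
  dom_nonempty : dom.Nonempty
  coord : OpenPartialHomeomorph N (Eu n) → ∀ x, Fib x → V
  change : OpenPartialHomeomorph N (Eu n) → OpenPartialHomeomorph N (Eu n) → Eu n × V → V
  injective : ∀ {φ x}, IsCoord φ → x ∈ φ.source → Function.Injective (coord φ x)
  range_eq : ∀ {φ x}, IsCoord φ → x ∈ φ.source → range (coord φ x) = dom
  contDiffOn_change : ∀ {φ ψ}, IsCoord φ → IsCoord ψ →
    ContDiffOn ℝ ∞ (change φ ψ) ((φ.symm ≫ₕ ψ).source ×ˢ dom)
  coord_change : ∀ {φ ψ x}, IsCoord φ → IsCoord ψ → x ∈ φ.source → x ∈ ψ.source →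
    ∀ b : Fib x, coord ψ x b = change φ ψ (φ x, coord φ x b)

namespace FibreCoords

variable {Fib : N → Type*} {V : Type*} [NormedAddCommGroup V] [NormedSpace ℝ V]

theorem nonempty (F : FibreCoords n N Fib V) (x : N) : Nonempty (Fib x) := by
  obtain ⟨v, hv⟩ := F.dom_nonempty
  have hφ : IsCoord (chartAt (Eu n) x) := IsManifold.chart_mem_maximalAtlas x
  rw [← F.range_eq hφ (mem_chart_source _ x)] at hv
  exact ⟨hv.choose⟩

/-- The coordinates `(x, coord φ x b)` on the part of the total space over `φ.source`. -/
def chart (F : FibreCoords n N Fib V) (φ : OpenPartialHomeomorph N (Eu n)) (hφ : IsCoord φ) :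
    PartialEquiv (Σ x, Fib x) (Eu n × V) where
  toFun b := (φ b.1, F.coord φ b.1 b.2)
  invFun q := ⟨φ.symm q.1,
    @Function.invFun _ _ (F.nonempty (φ.symm q.1)) (F.coord φ (φ.symm q.1)) q.2⟩
  source := {b | b.1 ∈ φ.source}
  target := φ.target ×ˢ F.dom
  map_source' b hb := ⟨φ.map_source hb, by
    rw [← F.range_eq hφ hb]; exact mem_range_self _⟩
  map_target' q hq := φ.map_target hq.1
  left_inv' := by
    rintro ⟨x, b⟩ hb
    have key : ∀ x', x' = x → (⟨x', @Function.invFun _ _ (F.nonempty x') (F.coord φ x')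
        (F.coord φ x b)⟩ : Σ x, Fib x) = ⟨x, b⟩ := by
      rintro _ rfl
      rw [@Function.leftInverse_invFun _ _ (F.nonempty _) _ (F.injective hφ hb)]
    exact key _ (φ.left_inv hb)
  right_inv' := by
    rintro ⟨u, v⟩ ⟨hu, hv⟩
    have hs : φ.symm u ∈ φ.source := φ.map_target hu
    rw [← F.range_eq hφ hs] at hv
    exact Prod.ext (φ.right_inv hu) (@Function.invFun_eq _ _ (F.nonempty _) _ _ hv)

theorem chart_change (F : FibreCoords n N Fib V) (hφ : IsCoord φ) (hψ : IsCoord ψ) {q : Eu n × V}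
    (hq : q ∈ ((F.chart φ hφ).symm.trans (F.chart ψ hψ)).source) :
    q ∈ (φ.symm ≫ₕ ψ).source ×ˢ F.dom ∧
    ((F.chart φ hφ).symm.trans (F.chart ψ hψ)) q = ((ψ ∘ φ.symm) q.1, F.change φ ψ q) := by
  obtain ⟨⟨h1, h2⟩, h3⟩ := hq
  have hs : φ.symm q.1 ∈ φ.source := φ.map_target h1
  have h3' : φ.symm q.1 ∈ ψ.source := h3
  refine ⟨⟨?_, h2⟩, Prod.ext rfl ?_⟩
  · simp only [mfld_simps]; exact ⟨h1, h3'⟩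
  · change F.coord ψ (φ.symm q.1) (@Function.invFun _ _ (F.nonempty (φ.symm q.1))
      (F.coord φ (φ.symm q.1)) q.2) = F.change φ ψ q
    rw [F.coord_change hφ hψ hs h3', φ.right_inv h1]
    rw [← F.range_eq hφ hs] at h2
    congr 2
    exact @Function.invFun_eq _ _ (F.nonempty _) _ _ h2

theorem source_change (F : FibreCoords n N Fib V) (hφ : IsCoord φ) (hψ : IsCoord ψ) :
    ((F.chart φ hφ).symm.trans (F.chart ψ hψ)).source = (φ.symm ≫ₕ ψ).source ×ˢ F.dom := by
  apply Subset.antisymm (fun q hq => (F.chart_change hφ hψ hq).1)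
  rintro q ⟨h1, h2⟩
  simp only [mfld_simps] at h1
  exact ⟨⟨h1.1, h2⟩, h1.2⟩

theorem contDiffOn_chart_change (F : FibreCoords n N Fib V) (hφ : IsCoord φ) (hψ : IsCoord ψ) :
    ContDiffOn ℝ ∞ ((F.chart φ hφ).symm.trans (F.chart ψ hψ))
      ((F.chart φ hφ).symm.trans (F.chart ψ hψ)).source := by
  have h : ContDiffOn ℝ ∞ (fun q : Eu n × V => ((ψ ∘ φ.symm) q.1, F.change φ ψ q))
      ((φ.symm ≫ₕ ψ).source ×ˢ F.dom) :=
    ((hφ.contDiffOn_change hψ).comp contDiff_fst.contDiffOn fun q hq => hq.1).prodMk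
      (F.contDiffOn_change hφ hψ)
  rw [← F.source_change hφ hψ] at h
  exact h.congr fun q hq => (F.chart_change hφ hψ hq).2

/-- The smooth atlas of the total space. -/
def core (F : FibreCoords n N Fib V) : ChartedSpaceCore (Eu n × V) (Σ x, Fib x) where
  atlas := {e | ∃ φ, ∃ hφ : IsCoord φ, e = F.chart φ hφ}
  chartAt b := F.chart (chartAt (Eu n) b.1) (IsManifold.chart_mem_maximalAtlas b.1)
  mem_chart_source b := mem_chart_source (Eu n) b.1
  chart_mem_atlas b := ⟨_, _, rfl⟩
  open_source := by
    rintro _ _ ⟨φ, hφ, rfl⟩ ⟨ψ, hψ, rfl⟩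
    rw [F.source_change hφ hψ]
    exact (φ.symm ≫ₕ ψ).open_source.prod F.isOpen_dom
  continuousOn_toFun := by
    rintro _ _ ⟨φ, hφ, rfl⟩ ⟨ψ, hψ, rfl⟩
    exact (F.contDiffOn_chart_change hφ hψ).continuousOn

theorem isManifold (F : FibreCoords n N Fib V) :
    @IsManifold ℝ _ (Eu n × V) _ _ (Eu n × V) _ 𝓘(ℝ, Eu n × V) ∞ (Σ x, Fib x)
      F.core.toTopologicalSpace F.core.toChartedSpace := by
  let _ := F.core.toTopologicalSpace
  let _ := F.core.toChartedSpace
  apply isManifold_of_contDiffOn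
  intro e e' he he'
  obtain ⟨_, ⟨_, rfl⟩, _, ⟨⟨φ, hφ, rfl⟩, rfl⟩, rfl⟩ := he
  obtain ⟨_, ⟨_, rfl⟩, _, ⟨⟨ψ, hψ, rfl⟩, rfl⟩, rfl⟩ := he'
  simpa using! F.contDiffOn_chart_change hφ hψ

end FibreCoords

/-! ### The bundle of linear connections -/

variable (n N) in
/-- The Christoffel symbols as fibre coordinates for linear connections. -/
def connCoords : FibreCoords n N (LinConnAt n) (Arr n) where
  dom := univ
  isOpen_dom := isOpen_univ
  dom_nonempty := univ_nonempty
  coord φ _ Γ := christoffel φ Γ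
  change := christoffelChange
  injective := christoffel_injective
  range_eq hφ hx := range_eq_univ.2 fun A => ⟨_, christoffel_ofChristoffel hφ hx A⟩
  contDiffOn_change hφ hψ := contDiffOn_christoffelChange hφ hψ
  coord_change hφ hψ hx hx' Γ := christoffel_change hφ hψ hx hx' Γ

variable (n N) in
/-- The total space `C` of the bundle of linear connections on `N`. -/
abbrev ConnBundle : Type _ := Σ x : N, LinConnAt n x

instance : TopologicalSpace (ConnBundle n N) := (connCoords n N).core.toTopologicalSpace

instance : ChartedSpace (Eu n × Arr n) (ConnBundle n N) := (connCoords n N).core.toChartedSpace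

instance : IsManifold 𝓘(ℝ, Eu n × Arr n) ∞ (ConnBundle n N) := (connCoords n N).isManifold

/-- The projection `p_C : C → N`. -/
def ConnBundle.proj (c : ConnBundle n N) : N := c.1


/-! ### The bundle of pseudo-Riemannian metrics -/

/-- The sign `ε_h`: `1` for the first `p` indices and `-1` for the others. -/
def eps (p : ℕ) {n : ℕ} (h : Fin n) : ℝ := if h.val < p then 1 else -1

variable (n) in
/-- A pseudo-Riemannian metric on `T_xN` of signature `(p, n - p)`: a symmetric bilinear form that
has an orthonormal frame `X` with `p` plus and `n - p` minus signs. -/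
@[ext]
structure MetricAt (p : ℕ) (x : N) where
  form : TangentSpace (𝓡 n) x →ₗ[ℝ] TangentSpace (𝓡 n) x →ₗ[ℝ] ℝ
  symm : ∀ v w, form v w = form w v
  exists_frame : ∃ X : Fin n → TangentSpace (𝓡 n) x,
    ∀ i j, form (X i) (X j) = if i = j then eps p i else 0

/-- Arrays `y_{ij}`, `i ≤ j`. -/
abbrev SymArr (n : ℕ) : Type := {q : Fin n × Fin n // q.1 ≤ q.2} → ℝ

/-- The symmetric matrix with upper triangular part `y`. -/
def SymArr.mat (y : SymArr n) : Matrix (Fin n) (Fin n) ℝ :=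
  fun i j => y ⟨(min i j, max i j), min_le_max⟩

/-- The upper triangular part of a matrix. -/
def SymArr.ofMat (Y : Matrix (Fin n) (Fin n) ℝ) : SymArr n := fun q => Y q.1.1 q.1.2

theorem SymArr.mat_symm (y : SymArr n) (i j : Fin n) : y.mat i j = y.mat j i := by
  simp only [mat]; congr 2; rw [min_comm, max_comm]

theorem SymArr.ofMat_mat (y : SymArr n) : ofMat y.mat = y := by
  funext ⟨⟨i, j⟩, h⟩
  simp only [ofMat, mat]
  congr 2
  rw [min_eq_left h, max_eq_right h]

theorem SymArr.mat_ofMat {Y : Matrix (Fin n) (Fin n) ℝ} (h : ∀ i j, Y i j = Y j i) :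
    (ofMat Y).mat = Y := by
  funext i j
  simp only [ofMat, mat]
  rcases le_total i j with hij | hij
  · rw [min_eq_left hij, max_eq_right hij]
  · rw [min_eq_right hij, max_eq_left hij, h]

variable (n) in
/-- The diagonal matrix of signs. -/
def eta (p : ℕ) : Matrix (Fin n) (Fin n) ℝ := Matrix.diagonal (eps p)

variable (n) in
/-- The coefficients of the symmetric forms of signature `(p, n - p)`. -/
def sigSet (p : ℕ) : Set (SymArr n) :=
  {y | ∃ P : Matrix (Fin n) (Fin n) ℝ, P.transpose * y.mat * P = eta n p}

theorem eta_mul_eta (p : ℕ) : eta n p * eta n p = 1 := by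
  rw [eta, Matrix.diagonal_mul_diagonal, ← Matrix.diagonal_one]
  congr 1
  funext i
  simp only [eps]
  split_ifs <;> norm_num

theorem eta_mem_sigSet (p : ℕ) : SymArr.ofMat (eta n p) ∈ sigSet n p := by
  refine ⟨1, ?_⟩
  rw [SymArr.mat_ofMat]
  · simp
  · intro i j
    exact congrFun (congrFun (Matrix.diagonal_transpose (eps p)).symm i) j

theorem isUnit_of_mul_eta {P Y : Matrix (Fin n) (Fin n) ℝ} {p : ℕ}
    (h : P.transpose * Y * P = eta n p) : IsUnit P.det := by
  have h1 : (eta n p * P.transpose * Y) * P = 1 := by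
    rw [Matrix.mul_assoc, Matrix.mul_assoc, ← Matrix.mul_assoc P.transpose, h, eta_mul_eta]
  exact (Matrix.isUnit_iff_isUnit_det _).1 (IsUnit.of_mul_eq_one_right _ h1)

/-- Near the model form, every symmetric form is congruent to it. -/
theorem nhds_eta (p : ℕ) :
    {y : SymArr n | ∃ Q : Matrix (Fin n) (Fin n) ℝ, IsUnit Q.det ∧ Q.transpose * eta n p * Q = y.mat} ∈
      𝓝 (SymArr.ofMat (eta n p)) := by
  let f : (Fin n → Fin n → ℝ) → SymArr n := fun Q q => ∑ h, Q h q.1.1 * (eps p h * Q h q.1.2)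
  let pr : Fin n → Fin n → (Fin n → Fin n → ℝ) →L[ℝ] ℝ := fun h i =>
    (ContinuousLinearMap.proj i : (Fin n → ℝ) →L[ℝ] ℝ) ∘L
      (ContinuousLinearMap.proj h : (Fin n → Fin n → ℝ) →L[ℝ] (Fin n → ℝ))
  let Q₀ : Fin n → Fin n → ℝ := fun i j => if i = j then 1 else 0
  let f' : (Fin n → Fin n → ℝ) →L[ℝ] SymArr n := ContinuousLinearMap.pi fun q =>
    ∑ h, (Q₀ h q.1.1 • (eps p h • pr h q.1.2) + (eps p h * Q₀ h q.1.2) • pr h q.1.1)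
  have hf : HasStrictFDerivAt f f' Q₀ := by
    refine hasStrictFDerivAt_pi.2 fun q => HasStrictFDerivAt.fun_sum fun h _ => ?_
    exact HasStrictFDerivAt.mul (x := Q₀) (c := fun Q => pr h q.1.1 Q) (d := fun Q => eps p h * pr h q.1.2 Q)
      (pr h q.1.1).hasStrictFDerivAt ((pr h q.1.2).hasStrictFDerivAt.const_mul (eps p h))
  have heps : ∀ h : Fin n, eps p h * eps p h = 1 := by
    intro h; simp only [eps]; split_ifs <;> norm_num
  have hsurj : f'.range = ⊤ := by
    refine LinearMap.range_eq_top.2 fun s => ⟨fun h j => eps p h * s.mat h j / 2, ?_⟩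
    funext q
    have h1 : f' (fun h j => eps p h * s.mat h j / 2) q =
        eps p q.1.1 * (eps p q.1.1 * s.mat q.1.1 q.1.2 / 2) +
        eps p q.1.2 * (eps p q.1.2 * s.mat q.1.2 q.1.1 / 2) := by
      simp [f', pr, Q₀, Finset.sum_add_distrib]
    change f' (fun h j => eps p h * s.mat h j / 2) q = s q
    have h2 : s.mat q.1.1 q.1.2 = s q := congrFun s.ofMat_mat q
    rw [h1, s.mat_symm q.1.2, h2]
    linear_combination (s q / 2) * (heps q.1.1 + heps q.1.2)
  have hmat : ∀ Q : Fin n → Fin n → ℝ,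
      f Q = SymArr.ofMat ((Matrix.of Q).transpose * eta n p * Matrix.of Q) := by
    intro Q
    funext q
    simp only [f, SymArr.ofMat, eta, Matrix.mul_apply, Matrix.transpose_apply,
      Matrix.of_apply, Matrix.diagonal_apply]
    simp [mul_assoc]
  have hQ₀ : Matrix.of Q₀ = 1 := by
    ext i j; simp [Q₀, Matrix.one_apply]
  have h0 : f Q₀ = SymArr.ofMat (eta n p) := by
    rw [hmat, hQ₀]; simp
  rw [← h0, ← hf.map_nhds_eq_of_surj hsurj, mem_map]
  have hdet : Continuous fun Q : Fin n → Fin n → ℝ => (Matrix.of Q).det :=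
    Continuous.matrix_det continuous_id
  have hopen : {Q : Fin n → Fin n → ℝ | (Matrix.of Q).det ≠ 0} ∈ 𝓝 Q₀ := by
    refine (isOpen_ne.preimage hdet).mem_nhds ?_
    simp [hQ₀]
  filter_upwards [hopen] with Q hQ
  refine ⟨Matrix.of Q, isUnit_iff_ne_zero.2 hQ, ?_⟩
  rw [hmat, SymArr.mat_ofMat]
  intro i j
  have : ((Matrix.of Q).transpose * eta n p * Matrix.of Q).transpose =
      (Matrix.of Q).transpose * eta n p * Matrix.of Q := by
    simp [Matrix.transpose_mul, eta, Matrix.mul_assoc]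
  conv_lhs => rw [← this]
  rfl

theorem isOpen_sigSet (p : ℕ) : IsOpen (sigSet n p) := by
  rw [isOpen_iff_mem_nhds]
  rintro y ⟨P, hP⟩
  have hPu := isUnit_of_mul_eta hP
  let g : SymArr n → SymArr n := fun z => SymArr.ofMat (P.transpose * z.mat * P)
  have hg : Continuous g := by
    refine continuous_pi fun q => ?_
    simp only [g, SymArr.ofMat, SymArr.mat, Matrix.mul_apply, Matrix.transpose_apply]
    fun_prop
  have hgy : g y = SymArr.ofMat (eta n p) := by simp only [g, hP]
  have h1 := hg.continuousAt (x := y)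
  rw [ContinuousAt, hgy] at h1
  filter_upwards [h1 (nhds_eta p)] with z hz
  obtain ⟨Q, hQ, hz⟩ := hz
  have hsym : ∀ i j, (P.transpose * z.mat * P) i j = (P.transpose * z.mat * P) j i := by
    have : (P.transpose * z.mat * P).transpose = P.transpose * z.mat * P := by
      have hz : z.mat.transpose = z.mat := by
        ext i j; exact z.mat_symm j i
      simp [Matrix.transpose_mul, hz, Matrix.mul_assoc]
    intro i j
    conv_lhs => rw [← this]
    rfl
  rw [SymArr.mat_ofMat hsym] at hz
  refine ⟨P * Q⁻¹, ?_⟩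
  have hQ1 : Q * Q⁻¹ = 1 := Matrix.mul_nonsing_inv _ hQ
  have hQ2 : Q⁻¹.transpose * Q.transpose = 1 := by
    rw [← Matrix.transpose_mul, hQ1, Matrix.transpose_one]
  calc (P * Q⁻¹).transpose * z.mat * (P * Q⁻¹)
      = Q⁻¹.transpose * (P.transpose * z.mat * P) * Q⁻¹ := by
        simp only [Matrix.transpose_mul, Matrix.mul_assoc]
    _ = (Q⁻¹.transpose * Q.transpose) * eta n p * (Q * Q⁻¹) := by
        rw [← hz]; simp only [Matrix.mul_assoc]
    _ = eta n p := by rw [hQ1, hQ2]; simp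

/-- The components `y_{ij} = g(∂/∂xⁱ, ∂/∂xʲ)`, `i ≤ j`. -/
def metricCoord (φ : OpenPartialHomeomorph N (Eu n)) {p : ℕ} {x : N} (g : MetricAt n p x) : SymArr n :=
  SymArr.ofMat (Matrix.of fun i j => g.form (coordField φ i x) (coordField φ j x))

theorem metricCoord_mat (φ : OpenPartialHomeomorph N (Eu n)) {p : ℕ} (g : MetricAt n p x) (i j : Fin n) :
    (metricCoord φ g).mat i j = g.form (coordField φ i x) (coordField φ j x) := by
  rw [metricCoord, SymArr.mat_ofMat, Matrix.of_apply]
  intro i j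
  exact g.symm _ _

theorem metric_expand (hφ : IsCoord φ) (hx : x ∈ φ.source) {p : ℕ} (g : MetricAt n p x)
    (v w : TangentSpace (𝓡 n) x) :
    g.form v w = ∑ i, ∑ j, dx φ i x v * dx φ j x w * (metricCoord φ g).mat i j := by
  conv_lhs => rw [coord_decomp hφ hx v, coord_decomp hφ hx w]
  simp only [map_sum, map_smul, LinearMap.sum_apply, LinearMap.smul_apply, smul_eq_mul,
    metricCoord_mat, Finset.mul_sum]
  rw [Finset.sum_comm]
  exact Finset.sum_congr rfl fun i _ => Finset.sum_congr rfl fun j _ => by ring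

theorem metricCoord_injective (hφ : IsCoord φ) (hx : x ∈ φ.source) {p : ℕ} :
    Function.Injective (metricCoord φ : MetricAt n p x → SymArr n) := by
  intro g g' h
  ext v w
  rw [metric_expand hφ hx g, metric_expand hφ hx g', h]

theorem range_metricCoord (hφ : IsCoord φ) (hx : x ∈ φ.source) {p : ℕ} :
    range (metricCoord φ : MetricAt n p x → SymArr n) = sigSet n p := by
  apply Subset.antisymm
  · rintro _ ⟨g, rfl⟩
    obtain ⟨X, hX⟩ := g.exists_frame
    refine ⟨Matrix.of fun i k => dx φ i x (X k), ?_⟩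
    ext k l
    rw [eta, Matrix.diagonal_apply, ← hX, metric_expand hφ hx]
    simp only [Matrix.mul_apply, Matrix.transpose_apply, Matrix.of_apply, Finset.sum_mul]
    rw [Finset.sum_comm]
    exact Finset.sum_congr rfl fun i _ => Finset.sum_congr rfl fun j _ => by ring
  · rintro y ⟨P, hP⟩
    let B : TangentSpace (𝓡 n) x →ₗ[ℝ] TangentSpace (𝓡 n) x →ₗ[ℝ] ℝ :=
      ∑ i, ∑ j, y.mat i j • (LinearMap.mul ℝ ℝ).compl₁₂ (dx φ i x : _ →ₗ[ℝ] ℝ) (dx φ j x : _ →ₗ[ℝ] ℝ)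
    have hB : ∀ v w, B v w = ∑ i, ∑ j, y.mat i j * (dx φ i x v * dx φ j x w) := by
      intro v w
      simp [B, LinearMap.sum_apply]
    refine ⟨⟨B, ?_, fun k => ∑ i, P i k • coordField φ i x, ?_⟩, ?_⟩
    · intro v w
      rw [hB, hB, Finset.sum_comm]
      refine Finset.sum_congr rfl fun i _ => Finset.sum_congr rfl fun j _ => ?_
      rw [y.mat_symm]; ring
    · intro k l
      have h1 := congrFun (congrFun hP k) l
      rw [eta, Matrix.diagonal_apply] at h1
      rw [← h1, hB]
      simp only [map_sum, map_smul, dx_coordField hφ hx, Matrix.mul_apply, Matrix.transpose_apply,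
        Finset.sum_mul]
      rw [Finset.sum_comm]
      refine Finset.sum_congr rfl fun i _ => Finset.sum_congr rfl fun j _ => ?_
      simp
      ring
    · refine Eq.trans ?_ y.ofMat_mat
      rw [metricCoord]
      congr 1
      ext i j
      change B _ _ = _
      rw [hB]
      simp [dx_coordField hφ hx]

/-- The transformation law of the components of a metric. -/
def metricChange (φ ψ : OpenPartialHomeomorph N (Eu n)) (q : Eu n × SymArr n) : SymArr n :=
  fun s => ∑ a, ∑ b, jac φ ψ a s.1.1 q.1 * jac φ ψ b s.1.2 q.1 * q.2.mat a b

theorem contDiffOn_metricChange (hφ : IsCoord φ) (hψ : IsCoord ψ) (D : Set (SymArr n)) :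
    ContDiffOn ℝ ∞ (metricChange φ ψ) ((φ.symm ≫ₕ ψ).source ×ˢ D) := by
  have hJ := fun a k => (contDiffOn_jac hφ hψ a k).comp
    (t := (φ.symm ≫ₕ ψ).source) (s := (φ.symm ≫ₕ ψ).source ×ˢ D)
    (contDiff_fst.contDiffOn) fun q hq => hq.1
  refine contDiffOn_pi.2 fun s => ContDiffOn.sum fun a _ => ContDiffOn.sum fun b _ => ?_
  refine ((hJ a _).mul (hJ b _)).mul ?_
  simp only [SymArr.mat]
  fun_prop

theorem metric_change (hφ : IsCoord φ) (hψ : IsCoord ψ) (hx : x ∈ φ.source) (hx' : x ∈ ψ.source)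
    {p : ℕ} (g : MetricAt n p x) :
    metricCoord ψ g = metricChange φ ψ (φ x, metricCoord φ g) := by
  funext s
  simp only [metricChange]
  change g.form _ _ = _
  rw [metric_expand hφ hx]
  simp only [dx_coordField_jac hφ hψ hx hx']

variable (n N) in
/-- The coordinates `(y_{ij}, Aⁱ_{jk})` as fibre coordinates for pairs (metric, linear connection). -/
def metricConnCoords (p : ℕ) :
    FibreCoords n N (fun x => MetricAt n p x × LinConnAt n x) (SymArr n × Arr n) where
  dom := sigSet n p ×ˢ univ
  isOpen_dom := (isOpen_sigSet p).prod isOpen_univ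
  dom_nonempty := ⟨(_, 0), eta_mem_sigSet p, mem_univ _⟩
  coord φ _ b := (metricCoord φ b.1, christoffel φ b.2)
  change φ ψ q := (metricChange φ ψ (q.1, q.2.1), christoffelChange φ ψ (q.1, q.2.2))
  injective hφ hx := (metricCoord_injective hφ hx).prodMap (christoffel_injective hφ hx)
  range_eq hφ hx := by
    change range (Prod.map _ _) = _
    rw [range_prodMap, range_metricCoord hφ hx]
    congr 1
    exact (connCoords n N).range_eq hφ hx
  contDiffOn_change hφ hψ := by
    refine ContDiffOn.prodMk ?_ ?_
    · exact (contDiffOn_metricChange hφ hψ univ).comp (by fun_prop) fun q hq => ⟨hq.1, mem_univ _⟩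
    · exact (contDiffOn_christoffelChange hφ hψ).comp (by fun_prop) fun q hq => ⟨hq.1, mem_univ _⟩
  coord_change hφ hψ hx hx' b := Prod.ext (metric_change hφ hψ hx hx' _) (christoffel_change hφ hψ hx hx' _)

variable (n N) in
/-- The total space of the product bundle `M ×_N C`, where `M` is the bundle of metrics of
signature `(p, n - p)`. -/
abbrev MetricConnBundle (p : ℕ) : Type _ := Σ x : N, MetricAt n p x × LinConnAt n x

variable {p : ℕ}

instance : TopologicalSpace (MetricConnBundle n N p) := (metricConnCoords n N p).core.toTopologicalSpace

instance : ChartedSpace (Eu n × SymArr n × Arr n) (MetricConnBundle n N p) :=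
  (metricConnCoords n N p).core.toChartedSpace

instance : IsManifold 𝓘(ℝ, Eu n × SymArr n × Arr n) ∞ (MetricConnBundle n N p) :=
  (metricConnCoords n N p).isManifold

/-- The projection `M ×_N C → N`. -/
def MetricConnBundle.proj (e : MetricConnBundle n N p) : N := e.1

/-- The projection `pr₂ : M ×_N C → C`. -/
def MetricConnBundle.pr₂ (e : MetricConnBundle n N p) : ConnBundle n N := ⟨e.1, e.2.2⟩


/-! ### Smoothness of the projections -/

theorem ConnBundle.contMDiff_proj :
    ContMDiff 𝓘(ℝ, Eu n × Arr n) (𝓡 n) ∞ (ConnBundle.proj : ConnBundle n N → N) := by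
  intro c
  have h1 : ContMDiffAt 𝓘(ℝ, Eu n × Arr n) 𝓘(ℝ, Eu n × Arr n) ∞ (chartAt (Eu n × Arr n) c) c :=
    contMDiffAt_of_mem_maximalAtlas (IsManifold.chart_mem_maximalAtlas c) (mem_chart_source _ c)
  have h2 : ContMDiffAt (𝓡 n) (𝓡 n) ∞ (chartAt (Eu n) c.1).symm (chartAt (Eu n × Arr n) c c).1 :=
    contMDiffAt_symm_of_mem_maximalAtlas (IsManifold.chart_mem_maximalAtlas c.1)
      (mem_chart_target (Eu n) c.1)
  have h3 : ContMDiffAt 𝓘(ℝ, Eu n × Arr n) (𝓡 n) ∞ (Prod.fst : Eu n × Arr n → Eu n)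
      (chartAt (Eu n × Arr n) c c) := contDiff_fst.contMDiff.contMDiffAt
  refine (h2.comp c (h3.comp c h1)).congr_of_eventuallyEq ?_
  filter_upwards [(chartAt (Eu n × Arr n) c).open_source.mem_nhds (mem_chart_source _ c)] with c' hc'
  exact ((chartAt (Eu n) c.1).left_inv hc').symm

theorem MetricConnBundle.contMDiff_pr₂ :
    ContMDiff 𝓘(ℝ, Eu n × SymArr n × Arr n) 𝓘(ℝ, Eu n × Arr n) ∞
      (MetricConnBundle.pr₂ : MetricConnBundle n N p → ConnBundle n N) := by
  intro e
  have h1 : ContMDiffAt 𝓘(ℝ, Eu n × SymArr n × Arr n) 𝓘(ℝ, Eu n × SymArr n × Arr n) ∞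
      (chartAt (Eu n × SymArr n × Arr n) e) e :=
    contMDiffAt_of_mem_maximalAtlas (IsManifold.chart_mem_maximalAtlas e) (mem_chart_source _ e)
  have h2 : ContMDiffAt 𝓘(ℝ, Eu n × Arr n) 𝓘(ℝ, Eu n × Arr n) ∞
      (chartAt (Eu n × Arr n) e.pr₂).symm (chartAt (Eu n × Arr n) e.pr₂ e.pr₂) :=
    contMDiffAt_symm_of_mem_maximalAtlas (IsManifold.chart_mem_maximalAtlas e.pr₂)
      (mem_chart_target _ e.pr₂)
  have h3 : ContMDiffAt 𝓘(ℝ, Eu n × SymArr n × Arr n) 𝓘(ℝ, Eu n × Arr n) ∞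
      (fun q : Eu n × SymArr n × Arr n => (q.1, q.2.2)) (chartAt (Eu n × SymArr n × Arr n) e e) :=
    (contDiff_fst.prodMk (contDiff_snd.comp contDiff_snd)).contMDiff.contMDiffAt
  refine (h2.comp e (h3.comp e h1)).congr_of_eventuallyEq ?_
  filter_upwards [(chartAt (Eu n × SymArr n × Arr n) e).open_source.mem_nhds
    (mem_chart_source _ e)] with e' he'
  exact ((chartAt (Eu n × Arr n) e.pr₂).left_inv (x := e'.pr₂) he').symm

/-! ### Ehresmann connections -/

/-- An Ehresmann connection on `p : P → N`: a smooth `1`-form on `P` with values in the vertical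
bundle `V(p) = ker p_*` which is the identity on `V(p)`. -/
structure EhresmannConnection (n : ℕ) {N : Type*} [TopologicalSpace N] [ChartedSpace (Eu n) N] (F : Type*) {P : Type*} [NormedAddCommGroup F] [NormedSpace ℝ F]
    [TopologicalSpace P] [ChartedSpace F P] [IsManifold 𝓘(ℝ, F) ∞ P] (p : P → N) where
  form : ∀ e : P, TangentSpace 𝓘(ℝ, F) e →L[ℝ] TangentSpace 𝓘(ℝ, F) e
  vertical : ∀ e X, mfderiv 𝓘(ℝ, F) (𝓡 n) p e (form e X) = 0
  id_on_vertical : ∀ e X, mfderiv 𝓘(ℝ, F) (𝓡 n) p e X = 0 → form e X = X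
  smooth : ContMDiff 𝓘(ℝ, F) (𝓘(ℝ, F).prod 𝓘(ℝ, F →L[ℝ] F)) ∞
    (fun e => (⟨e, form e⟩ : TotalSpace (F →L[ℝ] F)
      fun e : P => TangentSpace 𝓘(ℝ, F) e →L[ℝ] TangentSpace 𝓘(ℝ, F) e))

variable (n N p) in
/-- Ehresmann connections on `M ×_N C`. -/
abbrev EhresmannMC : Type _ :=
  EhresmannConnection n (Eu n × SymArr n × Arr n) (MetricConnBundle.proj : MetricConnBundle n N p → N)

variable (n N) in
/-- Ehresmann connections on `C`. -/
abbrev EhresmannC : Type _ :=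
  EhresmannConnection n (Eu n × Arr n) (ConnBundle.proj : ConnBundle n N → N)

/-- The component on `C` of the Ehresmann connection `γ` on `M ×_N C` is defined on `C` and equal to
`γC`: one has `pr₂_* (γ X) = γC (pr₂_* X)` for every tangent vector `X` of `M ×_N C`. -/
def IsConnComponent (γ : EhresmannMC n N p) (γC : EhresmannC n N) : Prop :=
  ∀ (e : MetricConnBundle n N p) (X : TangentSpace 𝓘(ℝ, Eu n × SymArr n × Arr n) e),
    mfderiv 𝓘(ℝ, Eu n × SymArr n × Arr n) 𝓘(ℝ, Eu n × Arr n) MetricConnBundle.pr₂ e (γ.form e X) =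
      γC.form e.pr₂
        (mfderiv 𝓘(ℝ, Eu n × SymArr n × Arr n) 𝓘(ℝ, Eu n × Arr n) MetricConnBundle.pr₂ e X)

/-- The tangent space of `C`. -/
abbrev TC (c : ConnBundle n N) : Type := TangentSpace 𝓘(ℝ, Eu n × Arr n) c

/-- The tangent space `T_xN` at the base point `x` of `c = Γ_x`: the fibre of `p_C^* TN` at `c`. -/
abbrev TN (c : ConnBundle n N) : Type := TangentSpace (𝓡 n) c.1

/-- The tangent map `(p_C)_*`. -/
def dproj (c : ConnBundle n N) : TC c →L[ℝ] TN c :=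
  mfderiv 𝓘(ℝ, Eu n × Arr n) (𝓡 n) ConnBundle.proj c

/-! ### Coordinates on `C` -/

/-- The coordinate function `Aⁱ_{jk}` on `C`. -/
def coordA (φ : OpenPartialHomeomorph N (Eu n)) (i j k : Fin n) (c : ConnBundle n N) : ℝ :=
  christoffel φ c.2 j k i

/-- The coordinate vector field `∂/∂xˡ` of the coordinate system `(xⁱ, Aⁱ_{jk})` of `C`. -/
def baseField (φ : OpenPartialHomeomorph N (Eu n)) (l : Fin n) (c : ConnBundle n N) : TC c :=
  (mvfderiv 𝓘(ℝ, Eu n × Arr n)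
    (fun c' : ConnBundle n N => ((φ c'.1, christoffel φ c'.2) : Eu n × Arr n)) c).inverse
    (EuclideanSpace.single l (1 : ℝ), 0)

/-- The components `γⁱ_{jkl}` of `γ_C = (dAⁱ_{jk} + γⁱ_{jkl} dxˡ) ⊗ ∂/∂Aⁱ_{jk}`, that is
`γⁱ_{jkl} = dAⁱ_{jk}(γ_C(∂/∂xˡ))`. -/
def gammaCoeff (γC : EhresmannC n N)
    (φ : OpenPartialHomeomorph N (Eu n)) (i j k l : Fin n) (c : ConnBundle n N) : ℝ :=
  mvfderiv 𝓘(ℝ, Eu n × Arr n) (coordA φ i j k : ConnBundle n N → ℝ) c (γC.form c (baseField φ l c))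

/-! ### The `2`-form `γ̃_C` and the operator `alt₁₂ ∘ γ_C` -/

variable (n) in
/-- Elements of `⊗² T*_xN ⊗ T_xN`. -/
abbrev Tensor (x : N) : Type _ :=
  TangentSpace (𝓡 n) x →ₗ[ℝ] TangentSpace (𝓡 n) x →ₗ[ℝ] TangentSpace (𝓡 n) x

/-- The identification `V(p_C) ≅ p_C^*(⊗² T*N ⊗ TN)`, `∂/∂Aⁱ_{jk} ↦ dxʲ ⊗ dxᵏ ⊗ ∂/∂xⁱ`, to be
applied to vertical vectors `Z`; see `vertTensor_velocity` for its coordinate-free description. -/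
def vertTensor (c : ConnBundle n N) (Z : TC c) : Tensor n c.1 :=
  let φ := chartAt (Eu n) c.1
  LinearMap.mk₂ ℝ (fun v w => ∑ i, (∑ j, ∑ k,
      mvfderiv 𝓘(ℝ, Eu n × Arr n) (coordA φ i j k : ConnBundle n N → ℝ) c Z *
        (dx φ j c.1 v * dx φ k c.1 w)) • coordField φ i c.1)
    (fun v v' w => by
      simp only [map_add, add_mul, mul_add, Finset.sum_add_distrib, add_smul])
    (fun a v w => by
      simp only [map_smul, smul_eq_mul, Finset.smul_sum, smul_smul, Finset.mul_sum]
      refine Finset.sum_congr rfl fun i _ => ?_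
      congr 1
      exact Finset.sum_congr rfl fun j _ => Finset.sum_congr rfl fun k _ => by ring)
    (fun v w w' => by
      simp only [map_add, mul_add, Finset.sum_add_distrib, add_smul])
    (fun a v w => by
      simp only [map_smul, smul_eq_mul, Finset.smul_sum, smul_smul, Finset.mul_sum]
      refine Finset.sum_congr rfl fun i _ => ?_
      congr 1
      exact Finset.sum_congr rfl fun j _ => Finset.sum_congr rfl fun k _ => by ring)

instance (x : N) : T2Space (TangentSpace (𝓡 n) x) := inferInstanceAs (T2Space (Eu n))

instance (x : N) : FiniteDimensional ℝ (TangentSpace (𝓡 n) x) :=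
  inferInstanceAs (FiniteDimensional ℝ (Eu n))

/-- The affine structure of the fibres of `C`: `∇ + B`. -/
def LinConnAt.addTensor (Γ : LinConnAt n x) (B : Tensor n x) : LinConnAt n x := by
  classical exact
  { toFun := fun σ => Γ.toFun σ + if DiffSec σ x then LinearMap.toContinuousLinearMap (B.flip (σ x)) else 0
    add := by
      intro σ τ hσ hτ
      rw [if_pos hσ, if_pos hτ, if_pos (mdifferentiableAt_add_section hσ hτ), Γ.add hσ hτ]
      ext1 v
      simp
      abel
    leibniz := by
      intro f σ hf hσ
      rw [if_pos hσ, if_pos (MDifferentiableAt.smul_section hf hσ), Γ.leibniz hf hσ]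
      ext1 v
      simp
      abel
    junk := fun h => by rw [if_neg h, Γ.junk h, add_zero] }

theorem christoffel_addTensor (hφ : IsCoord φ) (hx : x ∈ φ.source) (Γ : LinConnAt n x)
    (B : Tensor n x) (j k i : Fin n) :
    christoffel φ (Γ.addTensor B) j k i =
      christoffel φ Γ j k i + dx φ i x (B (coordField φ j x) (coordField φ k x)) := by
  simp [christoffel, LinConnAt.addTensor, mdiff_coordField hφ hx k]

theorem LinConnAt.addTensor_zero (Γ : LinConnAt n x) : Γ.addTensor 0 = Γ := by
  ext1
  funext σ
  simp only [addTensor]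
  have h : ∀ w, LinearMap.flip (0 : Tensor n x) w = 0 := fun w => by ext; simp
  simp [h]

theorem mdiff_coordA (hφ : IsCoord φ) (i j k : Fin n) {c : ConnBundle n N} (hc : c.1 ∈ φ.source) :
    MDifferentiableAt 𝓘(ℝ, Eu n × Arr n) 𝓘(ℝ, ℝ) (coordA φ i j k : ConnBundle n N → ℝ) c := by
  let e := (connCoords n N).core.openPartialHomeomorph ((connCoords n N).chart φ hφ) ⟨φ, hφ, rfl⟩
  have he : e ∈ IsManifold.maximalAtlas 𝓘(ℝ, Eu n × Arr n) ∞ (ConnBundle n N) := by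
    apply IsManifold.subset_maximalAtlas
    exact mem_iUnion₂.2 ⟨_, ⟨φ, hφ, rfl⟩, rfl⟩
  have h1 : ContMDiffAt 𝓘(ℝ, Eu n × Arr n) 𝓘(ℝ, Eu n × Arr n) ∞ e c :=
    contMDiffAt_of_mem_maximalAtlas he hc
  have h2 : ContMDiffAt 𝓘(ℝ, Eu n × Arr n) 𝓘(ℝ, ℝ) ∞ (fun q : Eu n × Arr n => q.2 j k i) (e c) := by
    have : ContDiff ℝ ∞ (fun q : Eu n × Arr n => q.2 j k i) := by fun_prop
    exact this.contMDiff.contMDiffAt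
  exact (h2.comp c h1).mdifferentiableAt (by simp)

/-- The vertical vector tangent at `Γ_x` to the curve `t ↦ Γ_x + t B` corresponds to `B`. -/
theorem vertTensor_velocity (c : ConnBundle n N) (B : Tensor n c.1) :
    vertTensor c (mfderiv 𝓘(ℝ, ℝ) 𝓘(ℝ, Eu n × Arr n)
      (fun t : ℝ => (⟨c.1, c.2.addTensor (t • B)⟩ : ConnBundle n N)) 0 (1 : ℝ)) = B := by
  have hφ : IsCoord (chartAt (Eu n) c.1) := IsManifold.chart_mem_maximalAtlas c.1
  have hx := mem_chart_source (Eu n) c.1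
  have h0 : (⟨c.1, c.2.addTensor ((0 : ℝ) • B)⟩ : ConnBundle n N) = c := by
    rw [zero_smul, c.2.addTensor_zero]
  set crv : ℝ → ConnBundle n N := fun t => ⟨c.1, c.2.addTensor (t • B)⟩ with hcrv
  have hsmooth : MDifferentiableAt 𝓘(ℝ, ℝ) 𝓘(ℝ, Eu n × Arr n) crv 0 := by
    have hd : ContMDiffAt 𝓘(ℝ, ℝ) 𝓘(ℝ, Eu n × Arr n) ∞ (fun t : ℝ =>
        ((chartAt (Eu n) c.1 c.1, fun j k i => christoffel (chartAt (Eu n) c.1) c.2 j k i +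
          t * dx (chartAt (Eu n) c.1) i c.1
            (B (coordField (chartAt (Eu n) c.1) j c.1) (coordField (chartAt (Eu n) c.1) k c.1))) :
          Eu n × Arr n)) 0 := by
      apply ContDiff.contMDiff
      refine contDiff_const.prodMk ?_
      fun_prop
    have h2 : ContMDiffAt 𝓘(ℝ, Eu n × Arr n) 𝓘(ℝ, Eu n × Arr n) ∞
        (chartAt (Eu n × Arr n) c).symm (chartAt (Eu n × Arr n) c c) :=
      contMDiffAt_symm_of_mem_maximalAtlas (IsManifold.chart_mem_maximalAtlas c)
        (mem_chart_target _ c)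
    have hchart : ∀ t, chartAt (Eu n × Arr n) c (crv t) = ((chartAt (Eu n) c.1 c.1,
        fun j k i => christoffel (chartAt (Eu n) c.1) c.2 j k i +
          t * dx (chartAt (Eu n) c.1) i c.1
            (B (coordField (chartAt (Eu n) c.1) j c.1) (coordField (chartAt (Eu n) c.1) k c.1))) :
          Eu n × Arr n) := by
      intro t
      refine Prod.ext rfl ?_
      funext j k i
      refine (christoffel_addTensor hφ hx c.2 (t • B) j k i).trans ?_
      simp
    have h3 := ContMDiffAt.comp_of_eq (x := (0 : ℝ)) h2 hd (by rw [← hchart 0, ← h0])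
    refine (h3.congr_of_eventuallyEq (.of_forall fun t => ?_)).mdifferentiableAt (by simp)
    simp only [Function.comp]
    rw [← hchart t]
    exact ((chartAt (Eu n × Arr n) c).left_inv (x := crv t) hx).symm
  have hder : ∀ i j k, mvfderiv 𝓘(ℝ, Eu n × Arr n)
      (coordA (chartAt (Eu n) c.1) i j k : ConnBundle n N → ℝ) c
      (mfderiv 𝓘(ℝ, ℝ) 𝓘(ℝ, Eu n × Arr n) crv 0 (1 : ℝ)) = dx (chartAt (Eu n) c.1) i c.1
        (B (coordField (chartAt (Eu n) c.1) j c.1) (coordField (chartAt (Eu n) c.1) k c.1)) := by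
    intro i j k
    have hA : MDifferentiableAt 𝓘(ℝ, Eu n × Arr n) 𝓘(ℝ, ℝ)
        (coordA (chartAt (Eu n) c.1) i j k : ConnBundle n N → ℝ) (crv 0) := by
      rw [show crv 0 = c from h0]
      exact mdiff_coordA hφ i j k hx
    have h1 := mvfderiv_comp_apply (0 : ℝ) hA hsmooth (1 : ℝ)
    rw [show crv 0 = c from h0] at h1
    refine h1.symm.trans ?_
    have h2 : (coordA (chartAt (Eu n) c.1) i j k ∘ crv) = fun t : ℝ =>
        christoffel (chartAt (Eu n) c.1) c.2 j k i + t * dx (chartAt (Eu n) c.1) i c.1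
        (B (coordField (chartAt (Eu n) c.1) j c.1) (coordField (chartAt (Eu n) c.1) k c.1)) := by
      funext t
      refine (christoffel_addTensor hφ hx c.2 (t • B) j k i).trans ?_
      simp
    rw [h2, mvfderiv, mfderiv_eq_fderiv]
    have h3 : ∀ a b : ℝ, fderiv ℝ (fun t : ℝ => a + t * b) (0 : ℝ) (1 : ℝ) = b := by
      intro a b
      simp
    exact h3 _ _
  ext v w
  apply coord_ext hφ hx
  intro i
  conv_rhs => rw [coord_decomp hφ hx v, coord_decomp hφ hx w]
  have hL : dx (chartAt (Eu n) c.1) i c.1 (vertTensor c (mfderiv 𝓘(ℝ, ℝ) 𝓘(ℝ, Eu n × Arr n)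
      crv 0 (1 : ℝ)) v w) = ∑ j, ∑ k, dx (chartAt (Eu n) c.1) i c.1
        (B (coordField (chartAt (Eu n) c.1) j c.1) (coordField (chartAt (Eu n) c.1) k c.1)) *
        (dx (chartAt (Eu n) c.1) j c.1 v * dx (chartAt (Eu n) c.1) k c.1 w) := by
    simp only [vertTensor, LinearMap.mk₂_apply, hder, map_sum, map_smul, dx_coordField hφ hx]
    simp
  rw [hL]
  simp only [map_sum, map_smul, LinearMap.sum_apply, LinearMap.smul_apply, smul_eq_mul,
    Finset.mul_sum]
  rw [Finset.sum_comm]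
  exact Finset.sum_congr rfl fun j _ => Finset.sum_congr rfl fun k _ => by ring

/-- The Ehresmann connection `γ_C` viewed as a homomorphism `TC → ⊗² T*N ⊗ TN`. -/
def gammaTensor (γC : EhresmannC n N) (c : ConnBundle n N) (X : TC c) : Tensor n c.1 :=
  vertTensor c (γC.form c X)

/-- `γ̃_C(X, Y) = c¹₁(p_* Y ⊗ γ_C(X)) - c¹₁(p_* X ⊗ γ_C(Y))`, an endomorphism of `T_xN`. -/
def gammaTilde (γC : EhresmannC n N) (c : ConnBundle n N) (X Y : TC c) : TN c →ₗ[ℝ] TN c :=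
  gammaTensor γC c X (dproj c Y) - gammaTensor γC c Y (dproj c X)

/-- The operator alternating the two covariant arguments. -/
def alt₁₂ {x : N} (B : Tensor n x) : Tensor n x := B - B.flip

/-! ### The canonical covariant derivatives and the torsion -/

/-- The canonical covariant derivative `∇⁽¹⁾` on `p_C^* TN`: writing a section as `s = sᵏ ∂/∂xᵏ`,
`∇_X s = X(sᵏ) ∂/∂xᵏ + sᵏ ∇^{Γ_x}_{p_* X} ∂/∂xᵏ` at `c = Γ_x`. -/
def nabla₁ (s : ∀ c : ConnBundle n N, TN c) (c : ConnBundle n N) : TC c →L[ℝ] TN c :=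
  let φ := chartAt (Eu n) c.1
  ∑ k, ((mvfderiv 𝓘(ℝ, Eu n × Arr n) (fun c' : ConnBundle n N => dx φ k c'.1 (s c')) c).smulRight
      (coordField φ k c.1) +
    dx φ k c.1 (s c) • (c.2.toFun (coordField φ k)) ∘L dproj c)

/-- The characteristic property of `∇⁽¹⁾`:
`∇_X (f ξ) = (X f) ξ + f ∇^{Γ_x}_{p_* X} ξ` for `f ∈ C^∞(C)` and `ξ` a vector field on `N`. -/
theorem nabla₁_smul (c : ConnBundle n N) {f : ConnBundle n N → ℝ}
    (hf : MDifferentiableAt 𝓘(ℝ, Eu n × Arr n) 𝓘(ℝ, ℝ) f c) {ξ : Π y : N, TangentSpace (𝓡 n) y}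
    (hξ : DiffSec ξ c.1) (X : TC c) :
    nabla₁ (fun c' => f c' • ξ c'.1) c X =
      mvfderiv 𝓘(ℝ, Eu n × Arr n) f c X • ξ c.1 + f c • c.2.toFun ξ (dproj c X) := by
  have hφ : IsCoord (chartAt (Eu n) c.1) := IsManifold.chart_mem_maximalAtlas c.1
  have hx := mem_chart_source (Eu n) c.1
  have hp : MDifferentiableAt 𝓘(ℝ, Eu n × Arr n) (𝓡 n) (ConnBundle.proj : ConnBundle n N → N) c :=
    ConnBundle.contMDiff_proj.mdifferentiable (by simp) c
  have hk : ∀ k, mvfderiv 𝓘(ℝ, Eu n × Arr n)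
      (fun c' : ConnBundle n N => dx (chartAt (Eu n) c.1) k c'.1 (f c' • ξ c'.1)) c X =
      f c * mvfderiv (𝓡 n) (fun y => dx (chartAt (Eu n) c.1) k y (ξ y)) c.1 (dproj c X) +
        dx (chartAt (Eu n) c.1) k c.1 (ξ c.1) * mvfderiv 𝓘(ℝ, Eu n × Arr n) f c X := by
    intro k
    have hm := mdiff_dx hφ hx k hξ
    have h1 : (fun c' : ConnBundle n N => dx (chartAt (Eu n) c.1) k c'.1 (f c' • ξ c'.1)) =
        f * ((fun y => dx (chartAt (Eu n) c.1) k y (ξ y)) ∘ ConnBundle.proj) := by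
      funext c'
      change dx (chartAt (Eu n) c.1) k c'.1 (f c' • ξ c'.1) = f c' * dx (chartAt (Eu n) c.1) k c'.1 (ξ c'.1)
      rw [map_smul, smul_eq_mul]
    rw [h1, mvfderiv_mul hf (MDifferentiableAt.comp c (f := ConnBundle.proj) hm hp)]
    have h2 := mvfderiv_comp_apply c (f := ConnBundle.proj) hm hp X
    simp only [add_apply, smul_apply, smul_eq_mul, h2]
    rfl
  rw [c.2.expand hφ hx hξ]
  conv_rhs => enter [1, 2]; rw [coord_decomp hφ hx (ξ c.1)]
  simp only [nabla₁, sum_apply, add_apply, smul_apply, ContinuousLinearMap.smulRight_apply, hk,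
    ContinuousLinearMap.comp_apply]
  simp only [map_smul, smul_eq_mul, Finset.smul_sum, ← Finset.sum_add_distrib]
  refine Finset.sum_congr rfl fun k _ => ?_
  module

theorem torsion_tensorial₁ (Γ : LinConnAt n x) (Y : Π y : N, TangentSpace (𝓡 n) y) (_hY : DiffSec Y x) :
    TensorialAt (𝓡 n) (Eu n) (fun X => Γ.toFun Y (X x) - Γ.toFun X (Y x) -
      VectorField.mlieBracket (𝓡 n) X Y x) x where
  smul hf hX := by
    have : IsManifold (𝓡 n) 2 N := IsManifold.of_le (n := ∞) two_le_infty
    simp [Γ.leibniz hf hX, VectorField.mlieBracket_smul_left hf hX]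
    module
  add hX hX' := by
    have : IsManifold (𝓡 n) 2 N := IsManifold.of_le (n := ∞) two_le_infty
    simp [Γ.add hX hX', VectorField.mlieBracket_add_left hX hX']
    module

theorem torsion_tensorial₂ (Γ : LinConnAt n x) (X : Π y : N, TangentSpace (𝓡 n) y) (_hX : DiffSec X x) :
    TensorialAt (𝓡 n) (Eu n) (fun Y => Γ.toFun Y (X x) - Γ.toFun X (Y x) -
      VectorField.mlieBracket (𝓡 n) X Y x) x where
  smul hf hY := by
    have : IsManifold (𝓡 n) 2 N := IsManifold.of_le (n := ∞) two_le_infty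
    simp [Γ.leibniz hf hY, VectorField.mlieBracket_smul_right hf hY]
    module
  add hY hY' := by
    have : IsManifold (𝓡 n) 2 N := IsManifold.of_le (n := ∞) two_le_infty
    simp [Γ.add hY hY', VectorField.mlieBracket_add_right hY hY']
    module

/-- The torsion tensor of `Γ_x`: `T(X, Y) = ∇_X Y - ∇_Y X - [X, Y]`. -/
def LinConnAt.torsion (Γ : LinConnAt n x) :
    TangentSpace (𝓡 n) x →L[ℝ] TangentSpace (𝓡 n) x →L[ℝ] TangentSpace (𝓡 n) x :=
  TensorialAt.mkHom₂ (fun X Y => Γ.toFun Y (X x) - Γ.toFun X (Y x) -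
    VectorField.mlieBracket (𝓡 n) X Y x) x (torsion_tensorial₁ Γ) (torsion_tensorial₂ Γ)

theorem LinConnAt.torsion_apply (Γ : LinConnAt n x) {X Y : Π y : N, TangentSpace (𝓡 n) y}
    (hX : DiffSec X x) (hY : DiffSec Y x) :
    Γ.torsion (X x) (Y x) = Γ.toFun Y (X x) - Γ.toFun X (Y x) -
      VectorField.mlieBracket (𝓡 n) X Y x :=
  TensorialAt.mkHom₂_apply _ _ hX hY

/-- The canonical section `τ_N(Γ_x) = T^{Γ_x}` of `p_C^*(∧² T*N ⊗ TN)`, as a field of (alternating)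
bilinear maps. -/
def tauN (c : ConnBundle n N) : Tensor n c.1 :=
  (ContinuousLinearMap.coeLM ℝ) ∘ₗ (c.2.torsion : TN c →ₗ[ℝ] TN c →L[ℝ] TN c)

/-- The canonical covariant derivative `∇⁽²⁾` on `p_C^*(∧² T*N ⊗ TN)`, induced by `∇⁽¹⁾`:
`(∇_X θ)(Y, Z) = ∇_X (θ(Y, Z)) - θ(∇_X Y, Z) - θ(Y, ∇_X Z)` for sections `Y, Z` of `p_C^* TN`. -/
def nabla₂ (θ : ∀ c : ConnBundle n N, Tensor n c.1) (Y Z : ∀ c : ConnBundle n N, TN c)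
    (c : ConnBundle n N) (X : TC c) : TN c :=
  nabla₁ (fun c' => θ c' (Y c') (Z c')) c X - θ c (nabla₁ Y c X) (Z c) - θ c (Y c) (nabla₁ Z c X)

/-- The curvature of `∇⁽¹⁾`: `R(X, Y) s = ∇_X ∇_Y s - ∇_Y ∇_X s - ∇_{[X, Y]} s` for vector fields
`X, Y` on `C` and a section `s` of `p_C^* TN`. -/
def curvature₁ (X Y : ∀ c : ConnBundle n N, TC c) (s : ∀ c : ConnBundle n N, TN c)
    (c : ConnBundle n N) : TN c :=
  nabla₁ (fun c' => nabla₁ s c' (Y c')) c (X c) - nabla₁ (fun c' => nabla₁ s c' (X c')) c (Y c) -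
    nabla₁ s c (VectorField.mlieBracket 𝓘(ℝ, Eu n × Arr n) X Y c)

/-- The vector field `X` on `C` is smooth at `c`. -/
abbrev SmoothFieldAt (X : ∀ c : ConnBundle n N, TC c) (c : ConnBundle n N) : Prop :=
  ContMDiffAt 𝓘(ℝ, Eu n × Arr n) 𝓘(ℝ, Eu n × Arr n).tangent ∞
    (fun c' => (⟨c', X c'⟩ : TangentBundle 𝓘(ℝ, Eu n × Arr n) (ConnBundle n N))) c

/-- The section `s` of `p_C^* TN` is smooth at `c` (as a map `C → TN` over `p_C`). -/
abbrev SmoothSecAt (s : ∀ c : ConnBundle n N, TN c) (c : ConnBundle n N) : Prop :=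
  ContMDiffAt 𝓘(ℝ, Eu n × Arr n) (𝓡 n).tangent ∞
    (fun c' => (⟨c'.1, s c'⟩ : TangentBundle (𝓡 n) N)) c

/-- The equation `γ̃_C = R^{∇⁽¹⁾}` at the point `c` of `C`. -/
def CurvatureEqAt (γC : EhresmannC n N) (c : ConnBundle n N) : Prop :=
  ∀ (X Y : ∀ c : ConnBundle n N, TC c) (s : ∀ c : ConnBundle n N, TN c),
    SmoothFieldAt X c → SmoothFieldAt Y c → SmoothSecAt s c →
    gammaTilde γC c (X c) (Y c) (s c) = curvature₁ X Y s c

/-- The equation `alt₁₂ ∘ γ_C = ∇⁽²⁾ τ_N` at the point `c` of `C`. -/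
def TorsionEqAt (γC : EhresmannC n N) (c : ConnBundle n N) : Prop :=
  ∀ (X : TC c) (Y Z : ∀ c : ConnBundle n N, TN c), SmoothSecAt Y c → SmoothSecAt Z c →
    alt₁₂ (gammaTensor γC c X) (Y c) (Z c) = nabla₂ tauN Y Z c X

end Coordinates
end
end ConnBdl

open scoped Manifold ContDiff

/-! Both geometric equations become identities between components in the chart φ. There `∇⁽¹⁾` has
the connection form ωⁱ_k = Aⁱ_{jk} dxʲ, so its curvature is dω + ω∧ω, with dωⁱ_k = dAⁱ_{jk} ∧ dxʲ.
On the other side, γ̃_C has components (dAⁱ_{jk} + γⁱ_{jkl} dxˡ) ∧ dxʲ. The terms dAⁱ_{jk} ∧ dxʲ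
agree and cancel. The difference γ̃_C − R is therefore a combination of the dxʳ∧dxˢ alone, and its
coefficients are the differences of the two sides of (28).

The torsion equation works in the same way. The torsion has components Tⁱ_{jk} = Aⁱ_{jk} − Aⁱ_{kj},
so the leading term dTⁱ_{jk} of ∇⁽²⁾τ_N is exactly the dA-part of alt₁₂∘γ_C. After this cancellation
only dxᵗ-terms remain, with the differences of the two sides of (29) as coefficients.

In each case the difference of the two sides is a trilinear expression ∑ E_{rst} XʳYˢZᵗ in vectors
whose components can be prescribed freely. It vanishes identically if and only if every E_{rst}
does, as evaluation on coordinate fields shows.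

The analytic input is `mvfderiv_mlieBracket` (the bracket acts as a commutator, so second
derivatives of a section cancel in R) and `mlieBracket_coordField` (coordinate fields commute).
`vertTensor` and `nabla₁` are built with the preferred chart; `dx_vertTensor` and `dx_nabla₁`
express them in an arbitrary φ through their characteristic properties, with no use of the
transformation law of Christoffel symbols. `dx_curvature₁` and `dx_nabla₂_tauN` give the two
right-hand sides, `dx_gammaTensor` the left-hand sides, and `curvature_components` and
`torsion_components` carry out the cancellation. -/

namespace ConnBdl

/-! ### Vector fields as derivations, read in a chart. -/

section

variable {F : Type*} [NormedAddCommGroup F] [NormedSpace ℝ F] [CompleteSpace F]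
  {M : Type*} [TopologicalSpace M] [ChartedSpace F M] {x : M}

/-- A vector field read in the preferred chart at `x`. -/
noncomputable def chartField (V : Π y : M, TangentSpace 𝓘(ℝ, F) y) (x : M) : F → F :=
  VectorField.mpullbackWithin 𝓘(ℝ, F) 𝓘(ℝ, F) (extChartAt 𝓘(ℝ, F) x).symm V (range 𝓘(ℝ, F))

theorem mvfderiv_congr {f g : M → ℝ} (h : f =ᶠ[𝓝 x] g) :
    mvfderiv 𝓘(ℝ, F) f x = mvfderiv 𝓘(ℝ, F) g x := by
  ext v
  change mfderiv 𝓘(ℝ, F) 𝓘(ℝ, ℝ) f x v = mfderiv 𝓘(ℝ, F) 𝓘(ℝ, ℝ) g x v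
  rw [h.mfderiv_eq]
  rfl

variable [IsManifold 𝓘(ℝ, F) 2 M]

theorem differentiableAt_chartField {V : Π y : M, TangentSpace 𝓘(ℝ, F) y}
    (hV : MDifferentiableAt 𝓘(ℝ, F) 𝓘(ℝ, F).tangent
      (fun y => (⟨y, V y⟩ : TangentBundle 𝓘(ℝ, F) M)) x) :
    DifferentiableAt ℝ (chartField V x) (extChartAt 𝓘(ℝ, F) x x) := by
  have h := (mdifferentiableWithinAt_univ.2 hV).differentiableWithinAt_mpullbackWithin_vectorField
  rw [← differentiableWithinAt_univ]
  simpa [chartField] using h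

/-- The derivative of a function along a vector, computed in the preferred chart at `x`. -/
theorem mvfderiv_eq_chart {f : M → ℝ} {y : M} (hy : y ∈ (extChartAt 𝓘(ℝ, F) x).source)
    (hf : MDifferentiableAt 𝓘(ℝ, F) 𝓘(ℝ, ℝ) f y) (v : TangentSpace 𝓘(ℝ, F) y) :
    mvfderiv 𝓘(ℝ, F) f y v = fderiv ℝ (f ∘ (extChartAt 𝓘(ℝ, F) x).symm) (extChartAt 𝓘(ℝ, F) x y)
      (mfderiv 𝓘(ℝ, F) 𝓘(ℝ, F) (extChartAt 𝓘(ℝ, F) x) y v) := by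
  have : IsManifold 𝓘(ℝ, F) 1 M := IsManifold.of_le (n := 2) one_le_two
  have ht := (extChartAt 𝓘(ℝ, F) x).map_source hy
  have hl := (extChartAt 𝓘(ℝ, F) x).left_inv hy
  have hs : MDifferentiableAt 𝓘(ℝ, F) 𝓘(ℝ, F) (extChartAt 𝓘(ℝ, F) x).symm
      (extChartAt 𝓘(ℝ, F) x y) := by
    rw [← mdifferentiableWithinAt_univ]
    simpa using mdifferentiableWithinAt_extChartAt_symm ht
  have he : MDifferentiableAt 𝓘(ℝ, F) 𝓘(ℝ, F) (extChartAt 𝓘(ℝ, F) x) y :=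
    mdifferentiableAt_extChartAt (by simpa using hy)
  have hg : MDifferentiableAt 𝓘(ℝ, F) 𝓘(ℝ, ℝ) (f ∘ (extChartAt 𝓘(ℝ, F) x).symm)
      (extChartAt 𝓘(ℝ, F) x y) :=
    MDifferentiableAt.comp _ (by rwa [hl]) hs
  have hc := mvfderiv_comp_apply y hg he v
  rw [mvfderiv_congr (g := (f ∘ (extChartAt 𝓘(ℝ, F) x).symm) ∘ extChartAt 𝓘(ℝ, F) x), hc,
    mvfderiv, mfderiv_eq_fderiv]
  · rfl
  · filter_upwards [(isOpen_extChartAt_source x).mem_nhds hy] with z hz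
    simp only [Function.comp, (extChartAt 𝓘(ℝ, F) x).left_inv hz]

/-- The pullback along the inverse chart applies the inverse of the derivative of the inverse chart,
and this is the derivative of the chart itself. -/
theorem mfderiv_extChartAt_apply {V : Π y : M, TangentSpace 𝓘(ℝ, F) y} {u : F}
    (hu : u ∈ (extChartAt 𝓘(ℝ, F) x).target) :
    mfderiv 𝓘(ℝ, F) 𝓘(ℝ, F) (extChartAt 𝓘(ℝ, F) x) ((extChartAt 𝓘(ℝ, F) x).symm u)
      (V ((extChartAt 𝓘(ℝ, F) x).symm u)) = chartField V x u := by
  have : IsManifold 𝓘(ℝ, F) 1 M := IsManifold.of_le (n := 2) one_le_two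
  have h := mfderivWithin_extChartAt_symm_comp_mfderiv_extChartAt (I := 𝓘(ℝ, F)) hu
  symm
  refine ((isInvertible_mfderivWithin_extChartAt_symm (I := 𝓘(ℝ, F)) hu).inverse_apply_eq).2 ?_
  exact (DFunLike.congr_fun h (V ((extChartAt 𝓘(ℝ, F) x).symm u))).symm

theorem mvfderiv_field_eq_chart {f : M → ℝ} {V : Π y : M, TangentSpace 𝓘(ℝ, F) y} {y : M}
    (hy : y ∈ (extChartAt 𝓘(ℝ, F) x).source) (hf : MDifferentiableAt 𝓘(ℝ, F) 𝓘(ℝ, ℝ) f y) :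
    mvfderiv 𝓘(ℝ, F) f y (V y) = fderiv ℝ (f ∘ (extChartAt 𝓘(ℝ, F) x).symm)
      (extChartAt 𝓘(ℝ, F) x y) (chartField V x (extChartAt 𝓘(ℝ, F) x y)) := by
  rw [mvfderiv_eq_chart hy hf,
    ← mfderiv_extChartAt_apply (V := V) ((extChartAt 𝓘(ℝ, F) x).map_source hy),
    (extChartAt 𝓘(ℝ, F) x).left_inv hy]

theorem contDiffAt_chart {f : M → ℝ} (hf : ContMDiffAt 𝓘(ℝ, F) 𝓘(ℝ, ℝ) 2 f x) :
    ContDiffAt ℝ 2 (f ∘ (extChartAt 𝓘(ℝ, F) x).symm) (extChartAt 𝓘(ℝ, F) x x) := by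
  have h := (contMDiffAt_iff.1 hf).2
  rw [← contDiffWithinAt_univ]
  simpa [Function.comp_def] using! h

/-- Being C² at a point, unlike being differentiable there, is an open condition. It makes V f a
well-behaved germ that can be differentiated again. -/
theorem eventually_mdifferentiableAt {f : M → ℝ} (hf : ContMDiffAt 𝓘(ℝ, F) 𝓘(ℝ, ℝ) 2 f x) :
    ∀ᶠ y in 𝓝 x, MDifferentiableAt 𝓘(ℝ, F) 𝓘(ℝ, ℝ) f y := by
  have : IsManifold 𝓘(ℝ, F) 1 M := IsManifold.of_le (n := 2) one_le_two
  filter_upwards [contMDiffAt_iff_contMDiffAt_nhds (by simp) |>.1 hf] with y hy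
  exact hy.mdifferentiableAt two_ne_zero

theorem mvfderiv_field_eventuallyEq_chart {f : M → ℝ} (V : Π y : M, TangentSpace 𝓘(ℝ, F) y)
    (hf : ContMDiffAt 𝓘(ℝ, F) 𝓘(ℝ, ℝ) 2 f x) :
    (fun y => mvfderiv 𝓘(ℝ, F) f y (V y)) =ᶠ[𝓝 x]
      (fun u => fderiv ℝ (f ∘ (extChartAt 𝓘(ℝ, F) x).symm) u (chartField V x u)) ∘
        extChartAt 𝓘(ℝ, F) x := by
  filter_upwards [eventually_mdifferentiableAt hf, extChartAt_source_mem_nhds (I := 𝓘(ℝ, F)) x] with y hy hy'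
  exact mvfderiv_field_eq_chart hy' hy

theorem differentiableAt_fderiv_chartField {f : M → ℝ} {V : Π y : M, TangentSpace 𝓘(ℝ, F) y}
    (hf : ContMDiffAt 𝓘(ℝ, F) 𝓘(ℝ, ℝ) 2 f x)
    (hV : MDifferentiableAt 𝓘(ℝ, F) 𝓘(ℝ, F).tangent
      (fun y => (⟨y, V y⟩ : TangentBundle 𝓘(ℝ, F) M)) x) :
    DifferentiableAt ℝ (fun u => fderiv ℝ (f ∘ (extChartAt 𝓘(ℝ, F) x).symm) u (chartField V x u))
      (extChartAt 𝓘(ℝ, F) x x) :=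
  (((contDiffAt_chart hf).fderiv_right (m := 1) (by norm_num)).differentiableAt
    one_ne_zero).clm_apply (differentiableAt_chartField hV)

theorem mdifferentiableAt_mvfderiv_field {f : M → ℝ} {V : Π y : M, TangentSpace 𝓘(ℝ, F) y}
    (hf : ContMDiffAt 𝓘(ℝ, F) 𝓘(ℝ, ℝ) 2 f x)
    (hV : MDifferentiableAt 𝓘(ℝ, F) 𝓘(ℝ, F).tangent
      (fun y => (⟨y, V y⟩ : TangentBundle 𝓘(ℝ, F) M)) x) :
    MDifferentiableAt 𝓘(ℝ, F) 𝓘(ℝ, ℝ) (fun y => mvfderiv 𝓘(ℝ, F) f y (V y)) x := by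
  have : IsManifold 𝓘(ℝ, F) 1 M := IsManifold.of_le (n := 2) one_le_two
  refine MDifferentiableAt.congr_of_eventuallyEq ?_ (mvfderiv_field_eventuallyEq_chart V hf)
  exact (differentiableAt_fderiv_chartField hf hV).mdifferentiableAt.comp x
    (mdifferentiableAt_extChartAt (mem_chart_source F x))

/-- This is the product rule V(W f) = D²f(V, W) + Df(DW·V) in the chart. Only the second term is
asymmetric in V and W, and it is the one that produces the bracket. -/
theorem mvfderiv_mvfderiv_field {f : M → ℝ} {V W : Π y : M, TangentSpace 𝓘(ℝ, F) y}
    (hf : ContMDiffAt 𝓘(ℝ, F) 𝓘(ℝ, ℝ) 2 f x)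
    (hW : MDifferentiableAt 𝓘(ℝ, F) 𝓘(ℝ, F).tangent
      (fun y => (⟨y, W y⟩ : TangentBundle 𝓘(ℝ, F) M)) x) :
    mvfderiv 𝓘(ℝ, F) (fun y => mvfderiv 𝓘(ℝ, F) f y (W y)) x (V x) =
      fderiv ℝ (fderiv ℝ (f ∘ (extChartAt 𝓘(ℝ, F) x).symm)) (extChartAt 𝓘(ℝ, F) x x)
        (chartField V x (extChartAt 𝓘(ℝ, F) x x)) (chartField W x (extChartAt 𝓘(ℝ, F) x x)) +
      fderiv ℝ (f ∘ (extChartAt 𝓘(ℝ, F) x).symm) (extChartAt 𝓘(ℝ, F) x x)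
        (fderiv ℝ (chartField W x) (extChartAt 𝓘(ℝ, F) x x)
          (chartField V x (extChartAt 𝓘(ℝ, F) x x))) := by
  rw [mvfderiv_field_eq_chart (mem_extChartAt_source x) (mdifferentiableAt_mvfderiv_field hf hW)]
  have hev : ((fun y => mvfderiv 𝓘(ℝ, F) f y (W y)) ∘ (extChartAt 𝓘(ℝ, F) x).symm)
      =ᶠ[𝓝 (extChartAt 𝓘(ℝ, F) x x)]
      fun u => fderiv ℝ (f ∘ (extChartAt 𝓘(ℝ, F) x).symm) u (chartField W x u) := by
    have h1 := (continuousAt_extChartAt_symm (I := 𝓘(ℝ, F)) x).tendsto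
    rw [extChartAt_to_inv x] at h1
    filter_upwards [h1.eventually (mvfderiv_field_eventuallyEq_chart W hf),
      (isOpen_extChartAt_target x).mem_nhds (mem_extChartAt_target x)] with u hu hu'
    simp only [Function.comp] at hu ⊢
    rw [hu, (extChartAt 𝓘(ℝ, F) x).right_inv hu']
  have h2 := (((contDiffAt_chart hf).fderiv_right (m := 1) (by norm_num)).differentiableAt
    one_ne_zero).hasFDerivAt.clm_apply (differentiableAt_chartField hW).hasFDerivAt
  rw [hev.fderiv_eq, h2.fderiv]
  simp [add_comm]

/-- The Lie bracket acts on functions as the commutator of derivations. -/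
theorem mvfderiv_mlieBracket {f : M → ℝ} {V W : Π y : M, TangentSpace 𝓘(ℝ, F) y}
    (hf : ContMDiffAt 𝓘(ℝ, F) 𝓘(ℝ, ℝ) 2 f x)
    (hV : MDifferentiableAt 𝓘(ℝ, F) 𝓘(ℝ, F).tangent
      (fun y => (⟨y, V y⟩ : TangentBundle 𝓘(ℝ, F) M)) x)
    (hW : MDifferentiableAt 𝓘(ℝ, F) 𝓘(ℝ, F).tangent
      (fun y => (⟨y, W y⟩ : TangentBundle 𝓘(ℝ, F) M)) x) :
    mvfderiv 𝓘(ℝ, F) f x (VectorField.mlieBracket 𝓘(ℝ, F) V W x) =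
      mvfderiv 𝓘(ℝ, F) (fun y => mvfderiv 𝓘(ℝ, F) f y (W y)) x (V x) -
        mvfderiv 𝓘(ℝ, F) (fun y => mvfderiv 𝓘(ℝ, F) f y (V y)) x (W x) := by
  have : IsManifold 𝓘(ℝ, F) 1 M := IsManifold.of_le (n := 2) one_le_two
  have hx := mem_extChartAt_source (I := 𝓘(ℝ, F)) x
  -- The bracket on M is the bracket of the chart representatives carried back by the inverse of the
  -- derivative of the chart; applying that derivative undoes this.
  have hbr : mfderiv 𝓘(ℝ, F) 𝓘(ℝ, F) (extChartAt 𝓘(ℝ, F) x) x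
      (VectorField.mlieBracket 𝓘(ℝ, F) V W x) =
      VectorField.lieBracket ℝ (chartField V x) (chartField W x) (extChartAt 𝓘(ℝ, F) x x) := by
    obtain ⟨e, he⟩ := isInvertible_mfderiv_extChartAt hx
    rw [← VectorField.mlieBracketWithin_univ, VectorField.mlieBracketWithin_apply, ← he]
    simp only [ContinuousLinearMap.inverse_equiv]
    refine (e.apply_symm_apply _).trans ?_
    rw [← VectorField.lieBracketWithin_univ]
    simp [chartField]
    rfl
  -- The two D²f terms cancel by symmetry of the second derivative; what is left is Df applied to
  -- the bracket in the model space.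
  rw [mvfderiv_eq_chart hx (hf.mdifferentiableAt two_ne_zero), hbr,
    mvfderiv_mvfderiv_field hf hW, mvfderiv_mvfderiv_field hf hV, VectorField.lieBracket, map_sub,
    ((contDiffAt_chart hf).isSymmSndFDerivAt (by simp)).eq]
  ring

end
end ConnBdl

/-! ### Induced coordinates on C and the components of an Ehresmann connection. -/

namespace ConnBdl

noncomputable section

section

variable {n : ℕ} {N : Type*} [TopologicalSpace N] [ChartedSpace (Eu n) N] [IsManifold (𝓡 n) ∞ N]
  {φ : OpenPartialHomeomorph N (Eu n)} {c : ConnBundle n N}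

instance : IsManifold 𝓘(ℝ, Eu n × Arr n) 2 (ConnBundle n N) :=
  IsManifold.of_le (n := ∞) two_le_infty

instance : IsManifold 𝓘(ℝ, Eu n × Arr n) 1 (ConnBundle n N) :=
  IsManifold.of_le (n := 2) one_le_two

variable (φ) in
/-- The induced coordinates `(xⁱ, Aⁱ_{jk})` on `C`. -/
def connChart (c : ConnBundle n N) : Eu n × Arr n := (φ c.1, christoffel φ c.2)

/-- The atlas defining C contains a chart for every coordinate system of N, not only for the
preferred ones. This is what allows an arbitrary φ in all later computations. -/
theorem exists_connChart (hφ : IsCoord φ) :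
    ∃ e ∈ IsManifold.maximalAtlas 𝓘(ℝ, Eu n × Arr n) ∞ (ConnBundle n N),
      (∀ c, e c = connChart φ c) ∧ ∀ c, c ∈ e.source ↔ c.1 ∈ φ.source := by
  refine ⟨(connCoords n N).core.openPartialHomeomorph ((connCoords n N).chart φ hφ) ⟨φ, hφ, rfl⟩,
    ?_, fun _ => rfl, fun _ => Iff.rfl⟩
  apply IsManifold.subset_maximalAtlas
  exact mem_iUnion₂.2 ⟨_, ⟨φ, hφ, rfl⟩, rfl⟩

theorem contMDiffAt_connChart (hφ : IsCoord φ) (hc : c.1 ∈ φ.source) :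
    ContMDiffAt 𝓘(ℝ, Eu n × Arr n) 𝓘(ℝ, Eu n × Arr n) ∞
      (connChart φ : ConnBundle n N → Eu n × Arr n) c := by
  obtain ⟨e, he, h1, h2⟩ := exists_connChart (N := N) hφ
  have h := contMDiffAt_of_mem_maximalAtlas he ((h2 c).2 hc)
  rwa [show (e : ConnBundle n N → Eu n × Arr n) = connChart φ from funext h1] at h

theorem isInvertible_mvfderiv_connChart (hφ : IsCoord φ) (hc : c.1 ∈ φ.source) :
    (mvfderiv 𝓘(ℝ, Eu n × Arr n) (connChart φ : ConnBundle n N → Eu n × Arr n) c).IsInvertible := by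
  obtain ⟨e, he, h1, h2⟩ := exists_connChart (N := N) hφ
  have he1 := IsManifold.maximalAtlas_subset_of_le (m := 1) (by simp) he
  have hm : e.MDifferentiable 𝓘(ℝ, Eu n × Arr n) 𝓘(ℝ, Eu n × Arr n) :=
    ⟨fun _ h => (mdifferentiableAt_of_mem_maximalAtlas he1 h).mdifferentiableWithinAt,
      fun _ h => (mdifferentiableAt_symm_of_mem_maximalAtlas he1 h).mdifferentiableWithinAt⟩
  rw [← show (e : ConnBundle n N → Eu n × Arr n) = connChart φ from funext h1]
  exact ⟨hm.mfderiv ((h2 c).2 hc), rfl⟩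

theorem eventually_mem_source (hc : c.1 ∈ φ.source) :
    ∀ᶠ c' : ConnBundle n N in 𝓝 c, c'.1 ∈ φ.source :=
  ConnBundle.contMDiff_proj.continuous.continuousAt.eventually (φ.open_source.mem_nhds hc)

/-- A continuous linear map is its own derivative. Hence dXⁱ and dAⁱ_{jk} are coordinates of the
image of X under the invertible derivative of `connChart`. -/
theorem mvfderiv_clm_connChart (hφ : IsCoord φ) (hc : c.1 ∈ φ.source) (L : Eu n × Arr n →L[ℝ] ℝ)
    (X : TC c) : mvfderiv 𝓘(ℝ, Eu n × Arr n) (fun c' : ConnBundle n N => L (connChart φ c')) c X =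
      L (mvfderiv 𝓘(ℝ, Eu n × Arr n) (connChart φ : ConnBundle n N → Eu n × Arr n) c X) := by
  have h := mvfderiv_comp_apply (g := L) c L.differentiableAt.mdifferentiableAt
    ((contMDiffAt_connChart hφ hc).mdifferentiableAt (by simp)) X
  refine h.trans ?_
  rw [mvfderiv, mfderiv_eq_fderiv, L.fderiv]
  rfl

variable (n) in
/-- The coordinate projection `(x, A) ↦ xⁱ`. -/
def projX (i : Fin n) : Eu n × Arr n →L[ℝ] ℝ :=
  (EuclideanSpace.proj i : Eu n →L[ℝ] ℝ) ∘L ContinuousLinearMap.fst ℝ (Eu n) (Arr n)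

variable (n) in
/-- The coordinate projection `(x, A) ↦ Aⁱ_{jk}`. -/
def projA (i j k : Fin n) : Eu n × Arr n →L[ℝ] ℝ :=
  (ContinuousLinearMap.proj i : (Fin n → ℝ) →L[ℝ] ℝ) ∘L
    (ContinuousLinearMap.proj k : (Fin n → Fin n → ℝ) →L[ℝ] (Fin n → ℝ)) ∘L
    (ContinuousLinearMap.proj j : Arr n →L[ℝ] (Fin n → Fin n → ℝ)) ∘L
    ContinuousLinearMap.snd ℝ (Eu n) (Arr n)

variable (φ) in
/-- The coordinate function `xⁱ` on `C`. -/
def coordX (i : Fin n) (c : ConnBundle n N) : ℝ := φ c.1 i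

theorem contMDiffAt_coordX (hφ : IsCoord φ) (hc : c.1 ∈ φ.source) (i : Fin n) :
    ContMDiffAt 𝓘(ℝ, Eu n × Arr n) 𝓘(ℝ, ℝ) ∞ (coordX φ i : ConnBundle n N → ℝ) c :=
  (projX n i).contMDiff.contMDiffAt.comp c (contMDiffAt_connChart hφ hc)

theorem mdifferentiableAt_proj :
    MDifferentiableAt 𝓘(ℝ, Eu n × Arr n) (𝓡 n) (ConnBundle.proj : ConnBundle n N → N) c :=
  ConnBundle.contMDiff_proj.mdifferentiable (by simp) c

variable (φ) in
/-- The component `dxⁱ(p_* X)` of a tangent vector of `C`. -/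
def dX (i : Fin n) (c : ConnBundle n N) (X : TC c) : ℝ := dx φ i c.1 (dproj c X)

variable (φ) in
/-- The component `dAⁱ_{jk}(X)` of a tangent vector of `C`. -/
def dA (i j k : Fin n) (c : ConnBundle n N) (X : TC c) : ℝ :=
  mvfderiv 𝓘(ℝ, Eu n × Arr n) (coordA φ i j k : ConnBundle n N → ℝ) c X

theorem dA_eq (hφ : IsCoord φ) (hc : c.1 ∈ φ.source) (i j k : Fin n) (X : TC c) :
    dA φ i j k c X = projA n i j k
      (mvfderiv 𝓘(ℝ, Eu n × Arr n) (connChart φ : ConnBundle n N → Eu n × Arr n) c X) :=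
  mvfderiv_clm_connChart hφ hc (projA n i j k) X

/-- The chain rule for φ ∘ p_C. It exhibits dxⁱ(p_* X) as the derivative of a function on C, so that
`mvfderiv_mlieBracket` applies to it. -/
theorem mvfderiv_coordX (hφ : IsCoord φ) (hc : c.1 ∈ φ.source) (i : Fin n) (X : TC c) :
    mvfderiv 𝓘(ℝ, Eu n × Arr n) (coordX φ i : ConnBundle n N → ℝ) c X = dX φ i c X := by
  have hφd := hφ.mdiff.mdifferentiableAt hc
  have h1 := mfderiv_comp_apply c (f := ConnBundle.proj) (g := φ) hφd mdifferentiableAt_proj X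
  have h2 : MDifferentiableAt 𝓘(ℝ, Eu n × Arr n) (𝓡 n) (φ ∘ ConnBundle.proj) c :=
    MDifferentiableAt.comp c (f := ConnBundle.proj) hφd mdifferentiableAt_proj
  have h3 := mvfderiv_comp_apply (g := (EuclideanSpace.proj i : Eu n →L[ℝ] ℝ)) c
    (EuclideanSpace.proj i : Eu n →L[ℝ] ℝ).differentiableAt.mdifferentiableAt h2 X
  refine h3.trans ?_
  rw [h1, mvfderiv, mfderiv_eq_fderiv, (EuclideanSpace.proj i : Eu n →L[ℝ] ℝ).fderiv]
  rfl

theorem dX_eq (hφ : IsCoord φ) (hc : c.1 ∈ φ.source) (i : Fin n) (X : TC c) :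
    dX φ i c X = projX n i
      (mvfderiv 𝓘(ℝ, Eu n × Arr n) (connChart φ : ConnBundle n N → Eu n × Arr n) c X) := by
  rw [← mvfderiv_coordX hφ hc]
  exact mvfderiv_clm_connChart hφ hc (projX n i) X

/-- The derivative of `connChart` is injective. -/
theorem tangent_ext (hφ : IsCoord φ) (hc : c.1 ∈ φ.source) {X Y : TC c}
    (hX : ∀ i, dX φ i c X = dX φ i c Y) (hA : ∀ i j k, dA φ i j k c X = dA φ i j k c Y) : X = Y := by
  obtain ⟨e, he⟩ := isInvertible_mvfderiv_connChart hφ hc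
  apply e.injective
  simp only [dX_eq hφ hc, dA_eq hφ hc, ← he] at hX hA
  refine Prod.ext ?_ ?_
  · ext i
    exact hX i
  · funext j k i
    exact hA i j k

theorem mvfderiv_baseField (hφ : IsCoord φ) (hc : c.1 ∈ φ.source) (l : Fin n) :
    mvfderiv 𝓘(ℝ, Eu n × Arr n) (connChart φ : ConnBundle n N → Eu n × Arr n) c
      (baseField φ l c) = (EuclideanSpace.single l (1 : ℝ), 0) := by
  obtain ⟨e, he⟩ := isInvertible_mvfderiv_connChart hφ hc
  have h : baseField φ l c = (mvfderiv 𝓘(ℝ, Eu n × Arr n)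
      (connChart φ : ConnBundle n N → Eu n × Arr n) c).inverse
        (EuclideanSpace.single l (1 : ℝ), 0) := rfl
  rw [h, ← he]
  simp

theorem dX_baseField (hφ : IsCoord φ) (hc : c.1 ∈ φ.source) (i l : Fin n) :
    dX φ i c (baseField φ l c) = if i = l then 1 else 0 := by
  rw [dX_eq hφ hc, mvfderiv_baseField hφ hc]
  simp [projX]

theorem dA_baseField (hφ : IsCoord φ) (hc : c.1 ∈ φ.source) (i j k l : Fin n) :
    dA φ i j k c (baseField φ l c) = 0 := by
  rw [dA_eq hφ hc, mvfderiv_baseField hφ hc]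
  simp [projA]

/-- ∂/∂xˡ is the pullback of a constant field along a chart. Its smoothness makes it an admissible
test field in `CurvatureEqAt`. -/
theorem contMDiffAt_baseField (hφ : IsCoord φ) (hc : c.1 ∈ φ.source) (l : Fin n) :
    SmoothFieldAt (baseField φ l : ∀ c : ConnBundle n N, TC c) c :=
  ContMDiffAt.mpullback_vectorField_preimage (I := 𝓘(ℝ, Eu n × Arr n)) (I' := 𝓘(ℝ, Eu n × Arr n))
    (f := (connChart φ : ConnBundle n N → Eu n × Arr n)) (x₀ := c) (m := ∞) (n := ∞)
    (V := fun _ => ((EuclideanSpace.single l (1 : ℝ), 0) : Eu n × Arr n))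
    (contMDiffAt_vectorSpace_iff_contDiffAt.2 contDiffAt_const)
    (contMDiffAt_connChart hφ hc) (isInvertible_mvfderiv_connChart hφ hc) (by simp)

theorem dproj_eq (hφ : IsCoord φ) (hc : c.1 ∈ φ.source) (X : TC c) :
    dproj c X = ∑ l, dX φ l c X • coordField φ l c.1 :=
  coord_decomp hφ hc (dproj c X)

/-- The components of the Ehresmann connection: `γ_C = (dAⁱ_{jk} + γⁱ_{jkl} dxˡ) ⊗ ∂/∂Aⁱ_{jk}`. -/
theorem dA_form (γC : EhresmannC n N) (hφ : IsCoord φ) (hc : c.1 ∈ φ.source) (i j k : Fin n)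
    (X : TC c) :
    dA φ i j k c (γC.form c X) =
      dA φ i j k c X + ∑ l, gammaCoeff γC φ i j k l c * dX φ l c X := by
  -- H is the lift of p_* X along the fields ∂/∂xˡ of C: it projects to p_* X and has no
  -- dA-component. Thus X − H is vertical and fixed by γ_C, and the coefficients γⁱ_{jkl} come from
  -- γ_C(H) alone.
  set H : TC c := ∑ l, dX φ l c X • baseField φ l c with hH
  have hdH : dproj c (X - H) = 0 := by
    apply coord_ext hφ hc
    intro i
    have h : ∀ l, dx φ i c.1 (dproj c (baseField φ l c)) = if i = l then 1 else 0 :=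
      fun l => dX_baseField hφ hc i l
    simp only [hH, map_sub, map_sum, map_smul, h, map_zero]
    simp [dX]
  have h1 := γC.id_on_vertical c (X - H) hdH
  have h2 : γC.form c X = X - H + γC.form c H := by
    rw [← h1, ← map_add, sub_add_cancel]
  have h3 : dA φ i j k c H = 0 := by
    have h := fun l => dA_baseField hφ hc i j k l
    simp only [dA] at h ⊢
    simp [hH, map_sum, h]
  have h4 : dA φ i j k c (γC.form c H) = ∑ l, gammaCoeff γC φ i j k l c * dX φ l c X := by
    simp only [hH, map_sum, map_smul, dA, gammaCoeff, smul_eq_mul]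
    exact Finset.sum_congr rfl fun l _ => mul_comm _ _
  rw [h2, ← h4]
  simp only [dA] at h3 ⊢
  rw [map_add, map_sub, h3, sub_zero]

/-- In the induced chart the base point stays fixed and the Christoffel symbols are affine in t. -/
theorem mdifferentiableAt_velocity (c : ConnBundle n N) (B : Tensor n c.1) :
    MDifferentiableAt 𝓘(ℝ, ℝ) 𝓘(ℝ, Eu n × Arr n)
      (fun t : ℝ => (⟨c.1, c.2.addTensor (t • B)⟩ : ConnBundle n N)) 0 := by
  have hφ : IsCoord (chartAt (Eu n) c.1) := IsManifold.chart_mem_maximalAtlas c.1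
  have hx := mem_chart_source (Eu n) c.1
  have h0 : (⟨c.1, c.2.addTensor ((0 : ℝ) • B)⟩ : ConnBundle n N) = c := by
    rw [zero_smul, c.2.addTensor_zero]
  set crv : ℝ → ConnBundle n N := fun t => ⟨c.1, c.2.addTensor (t • B)⟩ with hcrv
  have hd : ContMDiffAt 𝓘(ℝ, ℝ) 𝓘(ℝ, Eu n × Arr n) ∞ (fun t : ℝ =>
      ((chartAt (Eu n) c.1 c.1, fun j k i => christoffel (chartAt (Eu n) c.1) c.2 j k i +
        t * dx (chartAt (Eu n) c.1) i c.1
          (B (coordField (chartAt (Eu n) c.1) j c.1) (coordField (chartAt (Eu n) c.1) k c.1))) :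
        Eu n × Arr n)) 0 := by
    apply ContDiff.contMDiff
    refine contDiff_const.prodMk ?_
    fun_prop
  have h2 : ContMDiffAt 𝓘(ℝ, Eu n × Arr n) 𝓘(ℝ, Eu n × Arr n) ∞
      (chartAt (Eu n × Arr n) c).symm (chartAt (Eu n × Arr n) c c) :=
    contMDiffAt_symm_of_mem_maximalAtlas (IsManifold.chart_mem_maximalAtlas c)
      (mem_chart_target _ c)
  have hchart : ∀ t, chartAt (Eu n × Arr n) c (crv t) = ((chartAt (Eu n) c.1 c.1,
      fun j k i => christoffel (chartAt (Eu n) c.1) c.2 j k i +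
        t * dx (chartAt (Eu n) c.1) i c.1
          (B (coordField (chartAt (Eu n) c.1) j c.1) (coordField (chartAt (Eu n) c.1) k c.1))) :
        Eu n × Arr n) := by
    intro t
    refine Prod.ext rfl ?_
    funext j k i
    refine (christoffel_addTensor hφ hx c.2 (t • B) j k i).trans ?_
    simp
  have h3 := ContMDiffAt.comp_of_eq (x := (0 : ℝ)) h2 hd (by rw [← hchart 0, ← h0])
  refine (h3.congr_of_eventuallyEq (.of_forall fun t => ?_)).mdifferentiableAt (by simp)
  simp only [Function.comp]
  rw [← hchart t]
  exact ((chartAt (Eu n × Arr n) c).left_inv (x := crv t) hx).symm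

/-- The velocity at `t = 0` of the curve `t ↦ Γ_x + t B`. -/
def velocity (c : ConnBundle n N) (B : Tensor n c.1) : TC c :=
  mfderiv 𝓘(ℝ, ℝ) 𝓘(ℝ, Eu n × Arr n)
    (fun t : ℝ => (⟨c.1, c.2.addTensor (t • B)⟩ : ConnBundle n N)) 0 (1 : ℝ)

/-- In any chart the Christoffel symbols of Γ + tB are affine in t with the components of B as
slope. Together with `dproj_velocity`, this determines the velocity in every coordinate system. -/
theorem dA_velocity (hφ : IsCoord φ) (hc : c.1 ∈ φ.source) (B : Tensor n c.1) (i j k : Fin n) :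
    dA φ i j k c (velocity c B) = dx φ i c.1 (B (coordField φ j c.1) (coordField φ k c.1)) := by
  have h0 : (⟨c.1, c.2.addTensor ((0 : ℝ) • B)⟩ : ConnBundle n N) = c := by
    rw [zero_smul, c.2.addTensor_zero]
  set crv : ℝ → ConnBundle n N := fun t => ⟨c.1, c.2.addTensor (t • B)⟩ with hcrv
  have hA : MDifferentiableAt 𝓘(ℝ, Eu n × Arr n) 𝓘(ℝ, ℝ)
      (coordA φ i j k : ConnBundle n N → ℝ) (crv 0) := by
    rw [show crv 0 = c from h0]
    exact mdiff_coordA hφ i j k hc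
  have h1 := mvfderiv_comp_apply (0 : ℝ) hA (mdifferentiableAt_velocity c B) (1 : ℝ)
  rw [show crv 0 = c from h0] at h1
  refine h1.symm.trans ?_
  have h2 : (coordA φ i j k ∘ crv) = fun t : ℝ => christoffel φ c.2 j k i +
      t * dx φ i c.1 (B (coordField φ j c.1) (coordField φ k c.1)) := by
    funext t
    refine (christoffel_addTensor hφ hc c.2 (t • B) j k i).trans ?_
    simp
  rw [h2, mvfderiv, mfderiv_eq_fderiv]
  have h3 : ∀ a b : ℝ, fderiv ℝ (fun t : ℝ => a + t * b) (0 : ℝ) (1 : ℝ) = b := by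
    intro a b
    simp
  exact h3 _ _

/-- The curve t ↦ Γ + tB stays in one fibre. -/
theorem dproj_velocity (c : ConnBundle n N) (B : Tensor n c.1) : dproj c (velocity c B) = 0 := by
  have h0 : (⟨c.1, c.2.addTensor ((0 : ℝ) • B)⟩ : ConnBundle n N) = c := by
    rw [zero_smul, c.2.addTensor_zero]
  set crv : ℝ → ConnBundle n N := fun t => ⟨c.1, c.2.addTensor (t • B)⟩ with hcrv
  have h1 := mfderiv_comp_apply (0 : ℝ) (g := (ConnBundle.proj : ConnBundle n N → N)) (f := crv)
    mdifferentiableAt_proj (mdifferentiableAt_velocity c B) (1 : ℝ)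
  rw [show crv 0 = c from h0] at h1
  refine h1.symm.trans ?_
  rw [show ConnBundle.proj ∘ crv = fun _ => c.1 from rfl, mfderiv_const]
  rfl

/-- The velocity map does not mention coordinates, while `vertTensor` is written in the preferred
chart. That they are inverse on vertical vectors frees `vertTensor` from that chart. -/
theorem velocity_vertTensor {Z : TC c} (hZ : dproj c Z = 0) : velocity c (vertTensor c Z) = Z := by
  have hφ : IsCoord (chartAt (Eu n) c.1) := IsManifold.chart_mem_maximalAtlas c.1
  have hx := mem_chart_source (Eu n) c.1
  refine tangent_ext hφ hx (fun i => by rw [dX, dX, dproj_velocity, hZ]) fun i j k => ?_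
  rw [dA_velocity hφ hx]
  simp only [vertTensor, LinearMap.mk₂_apply, map_sum, map_smul, dx_coordField hφ hx]
  simp [dA]

/-- Since Z is the velocity of Γ + tB with B = `vertTensor c Z`, the lemma `dA_velocity` identifies
the components of B in the chart φ with the numbers dAⁱ_{jk}(Z); bilinearity does the rest. -/
theorem dx_vertTensor (hφ : IsCoord φ) (hc : c.1 ∈ φ.source) {Z : TC c} (hZ : dproj c Z = 0)
    (i : Fin n) (v w : TN c) :
    dx φ i c.1 (vertTensor c Z v w) =
      ∑ j, ∑ k, dA φ i j k c Z * (dx φ j c.1 v * dx φ k c.1 w) := by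
  have h : ∀ j k, dA φ i j k c Z =
      dx φ i c.1 (vertTensor c Z (coordField φ j c.1) (coordField φ k c.1)) := by
    intro j k
    rw [← dA_velocity hφ hc, velocity_vertTensor hZ]
  conv_lhs => rw [coord_decomp hφ hc v, coord_decomp hφ hc w]
  simp only [h, map_sum, map_smul, LinearMap.sum_apply, LinearMap.smul_apply, smul_eq_mul,
    Finset.mul_sum]
  rw [Finset.sum_comm]
  exact Finset.sum_congr rfl fun j _ => Finset.sum_congr rfl fun k _ => by ring

theorem dx_gammaTensor (γC : EhresmannC n N) (hφ : IsCoord φ) (hc : c.1 ∈ φ.source) (X : TC c)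
    (i : Fin n) (v w : TN c) :
    dx φ i c.1 (gammaTensor γC c X v w) = ∑ j, ∑ k,
      (dA φ i j k c X + ∑ l, gammaCoeff γC φ i j k l c * dX φ l c X) *
        (dx φ j c.1 v * dx φ k c.1 w) := by
  rw [gammaTensor, dx_vertTensor hφ hc (γC.vertical c X)]
  simp only [dA_form γC hφ hc]

end
end
end ConnBdl

/-! ### Covariant derivative, curvature and torsion in coordinates. -/

namespace ConnBdl

noncomputable section

section

variable {n : ℕ} {N : Type*} [TopologicalSpace N] [ChartedSpace (Eu n) N] [IsManifold (𝓡 n) ∞ N]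
  {φ : OpenPartialHomeomorph N (Eu n)} {c : ConnBundle n N}

/-- Differentiability at `c` of a real function on `C`. -/
abbrev DiffFun (f : ConnBundle n N → ℝ) (c : ConnBundle n N) : Prop :=
  MDifferentiableAt 𝓘(ℝ, Eu n × Arr n) 𝓘(ℝ, ℝ) f c

/-- The derivative of a real function on `C` along a tangent vector. -/
abbrev dirDeriv (f : ConnBundle n N → ℝ) (c : ConnBundle n N) (X : TC c) : ℝ :=
  mvfderiv 𝓘(ℝ, Eu n × Arr n) f c X

theorem dirDeriv_congr {f g : ConnBundle n N → ℝ} (h : f =ᶠ[𝓝 c] g) (X : TC c) :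
    dirDeriv f c X = dirDeriv g c X := by
  rw [dirDeriv, mvfderiv_congr h]

theorem dirDeriv_add {f g : ConnBundle n N → ℝ} (hf : DiffFun f c) (hg : DiffFun g c) (X : TC c) :
    dirDeriv (fun c' => f c' + g c') c X = dirDeriv f c X + dirDeriv g c X :=
  DFunLike.congr_fun (mvfderiv_add hf hg) X

theorem dirDeriv_sub {f g : ConnBundle n N → ℝ} (hf : DiffFun f c) (hg : DiffFun g c) (X : TC c) :
    dirDeriv (fun c' => f c' - g c') c X = dirDeriv f c X - dirDeriv g c X :=
  DFunLike.congr_fun (mvfderiv_sub hf hg) X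

theorem dirDeriv_mul {f g : ConnBundle n N → ℝ} (hf : DiffFun f c) (hg : DiffFun g c) (X : TC c) :
    dirDeriv (fun c' => f c' * g c') c X = f c * dirDeriv g c X + g c * dirDeriv f c X :=
  DFunLike.congr_fun (mvfderiv_mul hf hg) X

theorem diffFun_mul {f g : ConnBundle n N → ℝ} (hf : DiffFun f c) (hg : DiffFun g c) :
    DiffFun (fun c' => f c' * g c') c :=
  MDifferentiableAt.mul hf hg

/-- The sum rule at each induction step needs differentiability of the partial sum, so the two
claims are proved together. -/
theorem dirDeriv_sum_aux {ι : Type*} (S : Finset ι) {f : ι → ConnBundle n N → ℝ}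
    (hf : ∀ i, DiffFun (f i) c) :
    DiffFun (fun c' => ∑ i ∈ S, f i c') c ∧
      ∀ X, dirDeriv (fun c' => ∑ i ∈ S, f i c') c X = ∑ i ∈ S, dirDeriv (f i) c X := by
  classical
  induction S using Finset.induction_on with
  | empty =>
    refine ⟨mdifferentiableAt_const, fun X => ?_⟩
    simp only [Finset.sum_empty, dirDeriv, mvfderiv_const]
    rfl
  | insert a S ha ih =>
    simp only [Finset.sum_insert ha]
    refine ⟨MDifferentiableAt.add (hf a) ih.1, fun X => ?_⟩
    rw [dirDeriv_add (hf a) ih.1, ih.2]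

theorem diffFun_sum {ι : Type*} [Fintype ι] {f : ι → ConnBundle n N → ℝ}
    (hf : ∀ i, DiffFun (f i) c) : DiffFun (fun c' => ∑ i, f i c') c :=
  (dirDeriv_sum_aux Finset.univ hf).1

theorem dirDeriv_sum {ι : Type*} [Fintype ι] {f : ι → ConnBundle n N → ℝ}
    (hf : ∀ i, DiffFun (f i) c) (X : TC c) :
    dirDeriv (fun c' => ∑ i, f i c') c X = ∑ i, dirDeriv (f i) c X :=
  (dirDeriv_sum_aux Finset.univ hf).2 X

/-! ### Components of sections of `p_C^* TN` -/

variable (φ) in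
/-- The component `sⁱ` of a section of `p_C^* TN`. -/
def secComp (i : Fin n) (s : ∀ c : ConnBundle n N, TN c) (c : ConnBundle n N) : ℝ := dx φ i c.1 (s c)

/-- Near c the component is a linear coordinate of the tangent map of φ applied to s. Order 2 is
what `mvfderiv_mlieBracket` requires. -/
theorem SmoothSecAt.contMDiffAt_secComp (hφ : IsCoord φ) (hc : c.1 ∈ φ.source) {s : ∀ c : ConnBundle n N, TN c}
    (hs : SmoothSecAt s c) (i : Fin n) :
    ContMDiffAt 𝓘(ℝ, Eu n × Arr n) 𝓘(ℝ, ℝ) 2 (secComp φ i s) c := by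
  have hs2 : ContMDiffAt 𝓘(ℝ, Eu n × Arr n) (𝓡 n).tangent 2
    (fun c' => (⟨c'.1, s c'⟩ : TangentBundle (𝓡 n) N)) c := hs.of_le two_le_infty
  have h1 : ContMDiffOn (𝓡 n).tangent (𝓡 n).tangent 2 (tangentMapWithin (𝓡 n) (𝓡 n) φ φ.source)
      (π (Eu n) (TangentSpace (𝓡 n)) ⁻¹' φ.source) :=
    (contMDiffOn_of_mem_maximalAtlas hφ).contMDiffOn_tangentMapWithin
      (WithTop.coe_le_coe.2 (le_top : (2 + 1 : ℕ∞) ≤ ⊤)) φ.open_source.uniqueMDiffOn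
  have h2 : ContMDiffAt (𝓡 n).tangent (𝓡 n).tangent 2
      (tangentMapWithin (𝓡 n) (𝓡 n) φ φ.source) (⟨c.1, s c⟩ : TangentBundle (𝓡 n) N) := by
    refine (h1 _ hc).contMDiffAt ?_
    exact (φ.open_source.preimage (FiberBundle.continuous_proj _ _)).mem_nhds hc
  have h3 := contMDiff_snd_tangentBundle_modelSpace (Eu n) (𝓡 n) (n := 2)
  have h4 := (h3 _).comp c (h2.comp c hs2)
  have h5 : ContMDiffAt 𝓘(ℝ, Eu n × Arr n) 𝓘(ℝ, ℝ) 2 ((EuclideanSpace.proj i : Eu n →L[ℝ] ℝ) ∘ _)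
      c := (EuclideanSpace.proj i : Eu n →L[ℝ] ℝ).contMDiff.contMDiffAt.comp c h4
  refine h5.congr_of_eventuallyEq ?_
  filter_upwards [eventually_mem_source hc] with y hy
  simp only [Function.comp, tangentMapWithin, mfderivWithin_of_isOpen φ.open_source hy]
  rfl

theorem SmoothSecAt.diffFun_secComp (hφ : IsCoord φ) (hc : c.1 ∈ φ.source)
    {s : ∀ c : ConnBundle n N, TN c} (hs : SmoothSecAt s c) (i : Fin n) : DiffFun (secComp φ i s) c :=
  (hs.contMDiffAt_secComp hφ hc i).mdifferentiableAt two_ne_zero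

theorem smoothSecAt_coordField (hφ : IsCoord φ) (hc : c.1 ∈ φ.source) (k : Fin n) :
    SmoothSecAt (fun c' : ConnBundle n N => coordField φ k c'.1) c := by
  have h : ContMDiffAt (𝓡 n) (𝓡 n).tangent ∞
      (fun y => (⟨y, coordField φ k y⟩ : TangentBundle (𝓡 n) N)) c.1 :=
    ContMDiffAt.mpullback_vectorField_preimage (I := 𝓡 n) (I' := 𝓡 n) (f := φ) (x₀ := c.1) (n := ∞)
      (V := fun _ => (EuclideanSpace.single k (1 : ℝ) : Eu n))
      (contMDiffAt_vectorSpace_iff_contDiffAt.2 contDiffAt_const)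
      (contMDiffAt_of_mem_maximalAtlas hφ hc) (hφ.invertible hc) (by simp)
  exact ContMDiffAt.comp c (f := (ConnBundle.proj : ConnBundle n N → N)) h
    (ConnBundle.contMDiff_proj c)

theorem diffFun_coordA (hφ : IsCoord φ) (hc : c.1 ∈ φ.source) (i j k : Fin n) :
    DiffFun (coordA φ i j k) c :=
  mdiff_coordA hφ i j k hc

/-! ### The covariant derivative in coordinates -/

/-- Locality of ∇⁽¹⁾ permits replacing a section by an expansion that is valid only over the domain
of φ. -/
theorem nabla₁_congr {s t : ∀ c : ConnBundle n N, TN c} (h : ∀ᶠ c' in 𝓝 c, s c' = t c')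
    (X : TC c) : nabla₁ s c X = nabla₁ t c X := by
  have hm : ∀ k, mvfderiv 𝓘(ℝ, Eu n × Arr n)
      (fun c' : ConnBundle n N => dx (chartAt (Eu n) c.1) k c'.1 (s c')) c =
      mvfderiv 𝓘(ℝ, Eu n × Arr n)
      (fun c' : ConnBundle n N => dx (chartAt (Eu n) c.1) k c'.1 (t c')) c := fun k =>
    mvfderiv_congr (h.mono fun c' hc' => by simp only [hc'])
  simp only [nabla₁, hm, h.self_of_nhds]

/-- The hypothesis refers to the preferred chart because `nabla₁` differentiates components in that
chart. -/
theorem nabla₁_sum {ι : Type*} [Fintype ι] {s : ι → ∀ c : ConnBundle n N, TN c}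
    (hs : ∀ a k, DiffFun (secComp (chartAt (Eu n) c.1) k (s a)) c) (X : TC c) :
    nabla₁ (fun c' => ∑ a, s a c') c X = ∑ a, nabla₁ (s a) c X := by
  have hm : ∀ k, mvfderiv 𝓘(ℝ, Eu n × Arr n)
      (fun c' : ConnBundle n N => dx (chartAt (Eu n) c.1) k c'.1 (∑ a, s a c')) c X =
      ∑ a, mvfderiv 𝓘(ℝ, Eu n × Arr n)
      (fun c' : ConnBundle n N => dx (chartAt (Eu n) c.1) k c'.1 (s a c')) c X := by
    intro k
    simp only [map_sum]
    exact dirDeriv_sum (fun a => hs a k) X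
  simp only [nabla₁, sum_apply, add_apply, smul_apply, ContinuousLinearMap.smulRight_apply,
    ContinuousLinearMap.comp_apply, hm]
  rw [Finset.sum_comm]
  refine Finset.sum_congr rfl fun k _ => ?_
  rw [map_sum, Finset.sum_smul, Finset.sum_smul, Finset.sum_add_distrib]

/-- `(∇_X s)ⁱ = X(sⁱ) + Aⁱ_{jk} Xʲ sᵏ` in every coordinate system. -/
theorem dx_nabla₁ (hφ : IsCoord φ) (hc : c.1 ∈ φ.source) {s : ∀ c : ConnBundle n N, TN c}
    (hs : ∀ k, DiffFun (secComp φ k s) c) (X : TC c) (i : Fin n) :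
    dx φ i c.1 (nabla₁ s c X) = dirDeriv (secComp φ i s) c X +
      ∑ j, ∑ k, coordA φ i j k c * dX φ j c X * secComp φ k s c := by
  have hχ : IsCoord (chartAt (Eu n) c.1) := IsManifold.chart_mem_maximalAtlas c.1
  have hx := mem_chart_source (Eu n) c.1
  -- Near c the section is ∑ sᵏ ∂/∂xᵏ in the frame of φ. The characteristic property `nabla₁_smul`,
  -- with f = sᵏ and ξ = ∂/∂xᵏ, then gives the formula in φ although `nabla₁` is built from another
  -- chart.
  have h1 : nabla₁ s c X =
      nabla₁ (fun c' => ∑ k, secComp φ k s c' • coordField φ k c'.1) c X := by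
    refine nabla₁_congr ?_ X
    filter_upwards [eventually_mem_source hc] with c' hc'
    exact coord_decomp hφ hc' (s c')
  rw [h1, nabla₁_sum (s := fun k c' => secComp φ k s c' • coordField φ k c'.1)]
  · simp only [nabla₁_smul c (hs _) (mdiff_coordField hφ hc _), map_sum, map_add, map_smul,
      dx_coordField hφ hc, Finset.sum_add_distrib, smul_eq_mul]
    congr 1
    · simp
    · rw [Finset.sum_comm]
      refine Finset.sum_congr rfl fun k _ => ?_
      rw [dproj_eq hφ hc X]
      simp only [map_sum, map_smul, smul_eq_mul, Finset.mul_sum]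
      refine Finset.sum_congr rfl fun j _ => ?_
      rw [show dx φ i c.1 (c.2.toFun (coordField φ k) (coordField φ j c.1)) = coordA φ i j k c
        from rfl]
      ring
  -- In the preferred chart, the components of sᵃ ∂/∂xᵃ are sᵃ times components of a coordinate
  -- field of φ, pulled back from N.
  · intro a k
    have h2 : secComp (chartAt (Eu n) c.1) k (fun c' => secComp φ a s c' • coordField φ a c'.1) =
        fun c' => secComp φ a s c' *
          ((fun y => dx (chartAt (Eu n) c.1) k y (coordField φ a y)) ∘ ConnBundle.proj) c' := by
      funext c'
      exact map_smul _ _ _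
    rw [h2]
    exact diffFun_mul (hs a) (MDifferentiableAt.comp c (f := ConnBundle.proj)
      (mdiff_dx hχ hx k (mdiff_coordField hφ hc a)) mdifferentiableAt_proj)

/-! ### The curvature in coordinates -/

theorem SmoothFieldAt.diff {X : ∀ c : ConnBundle n N, TC c} (hX : SmoothFieldAt X c) :
    MDifferentiableAt 𝓘(ℝ, Eu n × Arr n) 𝓘(ℝ, Eu n × Arr n).tangent
      (fun c' => (⟨c', X c'⟩ : TangentBundle 𝓘(ℝ, Eu n × Arr n) (ConnBundle n N))) c :=
  ContMDiffAt.mdifferentiableAt hX (by simp)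

theorem eventually_mvfderiv_coordX (hφ : IsCoord φ) (hc : c.1 ∈ φ.source)
    (X : ∀ c : ConnBundle n N, TC c) (i : Fin n) :
    (fun c' => dX φ i c' (X c')) =ᶠ[𝓝 c] fun c' => dirDeriv (coordX φ i) c' (X c') := by
  filter_upwards [eventually_mem_source hc] with c' hc'
  exact (mvfderiv_coordX hφ hc' i (X c')).symm

theorem SmoothFieldAt.diffFun_dX (hφ : IsCoord φ) (hc : c.1 ∈ φ.source)
    {X : ∀ c : ConnBundle n N, TC c} (hX : SmoothFieldAt X c) (i : Fin n) :
    DiffFun (fun c' => dX φ i c' (X c')) c :=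
  (mdifferentiableAt_mvfderiv_field ((contMDiffAt_coordX hφ hc i).of_le two_le_infty)
    hX.diff).congr_of_eventuallyEq (eventually_mvfderiv_coordX hφ hc X i)

/-- The commutator formula applied to the function xⁱ, whose derivative along Y is Yⁱ near c. -/
theorem dX_mlieBracket (hφ : IsCoord φ) (hc : c.1 ∈ φ.source) {X Y : ∀ c : ConnBundle n N, TC c}
    (hX : SmoothFieldAt X c) (hY : SmoothFieldAt Y c) (i : Fin n) :
    dX φ i c (VectorField.mlieBracket 𝓘(ℝ, Eu n × Arr n) X Y c) =
      dirDeriv (fun c' => dX φ i c' (Y c')) c (X c) -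
        dirDeriv (fun c' => dX φ i c' (X c')) c (Y c) := by
  rw [dirDeriv_congr (eventually_mvfderiv_coordX hφ hc X i),
    dirDeriv_congr (eventually_mvfderiv_coordX hφ hc Y i), ← mvfderiv_coordX hφ hc]
  exact mvfderiv_mlieBracket ((contMDiffAt_coordX hφ hc i).of_le two_le_infty) hX.diff hY.diff

variable (φ) in
/-- The `i`-th component of `s ↦ ∇_X s - X(s)`: the connection form of `∇⁽¹⁾`. -/
def connForm (i : Fin n) (c : ConnBundle n N) (X : TC c) (s : ∀ c : ConnBundle n N, TN c) : ℝ :=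
  ∑ j, ∑ k, coordA φ i j k c * dX φ j c X * secComp φ k s c

/-- An equality of germs is needed, since ∇_X ∇_Y s differentiates ∇_Y s. It holds because the
components of s are C² at c and so differentiable at nearby points. -/
theorem secComp_nabla₁_eventuallyEq (hφ : IsCoord φ) (hc : c.1 ∈ φ.source)
    {s : ∀ c : ConnBundle n N, TN c} (hs : SmoothSecAt s c) (Y : ∀ c : ConnBundle n N, TC c)
    (i : Fin n) : secComp φ i (fun c' => nabla₁ s c' (Y c')) =ᶠ[𝓝 c] fun c' =>
      dirDeriv (secComp φ i s) c' (Y c') + connForm φ i c' (Y c') s := by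
  have h := eventually_all.2 fun k => eventually_mdifferentiableAt (hs.contMDiffAt_secComp hφ hc k)
  filter_upwards [h, eventually_mem_source hc] with c' h' hc'
  exact dx_nabla₁ hφ hc' h' (Y c') i

theorem diffFun_connForm (hφ : IsCoord φ) (hc : c.1 ∈ φ.source)
    {s : ∀ c : ConnBundle n N, TN c} (hs : SmoothSecAt s c) {Y : ∀ c : ConnBundle n N, TC c}
    (hY : SmoothFieldAt Y c) (i : Fin n) : DiffFun (fun c' => connForm φ i c' (Y c') s) c :=
  diffFun_sum fun j => diffFun_sum fun k => diffFun_mul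
    (diffFun_mul (diffFun_coordA hφ hc i j k) (hY.diffFun_dX hφ hc j)) (hs.diffFun_secComp hφ hc k)

/-- In the curvature, the first of the three terms yields dAⁱ_{jk} ∧ dxʲ. The second is absorbed by
∇_{[X,Y]}, and the third cancels against the outer connection term with X and Y exchanged. -/
theorem dirDeriv_connForm (hφ : IsCoord φ) (hc : c.1 ∈ φ.source)
    {s : ∀ c : ConnBundle n N, TN c} (hs : SmoothSecAt s c) {Y : ∀ c : ConnBundle n N, TC c}
    (hY : SmoothFieldAt Y c) (i : Fin n) (V : TC c) :
    dirDeriv (fun c' => connForm φ i c' (Y c') s) c V = ∑ j, ∑ k,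
      (dA φ i j k c V * dX φ j c (Y c) * secComp φ k s c +
        coordA φ i j k c * dirDeriv (fun c' => dX φ j c' (Y c')) c V * secComp φ k s c +
        coordA φ i j k c * dX φ j c (Y c) * dirDeriv (secComp φ k s) c V) := by
  have h1 := fun j k => diffFun_mul (diffFun_coordA hφ hc i j k) (hY.diffFun_dX hφ hc j)
  have h2 := fun k => hs.diffFun_secComp hφ hc k
  simp only [connForm]
  rw [dirDeriv_sum fun j => diffFun_sum fun k => diffFun_mul (h1 j k) (h2 k)]
  refine Finset.sum_congr rfl fun j _ => ?_
  rw [dirDeriv_sum fun k => diffFun_mul (h1 j k) (h2 k)]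
  refine Finset.sum_congr rfl fun k _ => ?_
  rw [dirDeriv_mul (h1 j k) (h2 k), dirDeriv_mul (diffFun_coordA hφ hc i j k)
    (hY.diffFun_dX hφ hc j), dA]
  ring

theorem dx_nabla₁_nabla₁ (hφ : IsCoord φ) (hc : c.1 ∈ φ.source)
    {s : ∀ c : ConnBundle n N, TN c} (hs : SmoothSecAt s c) {Y : ∀ c : ConnBundle n N, TC c}
    (hY : SmoothFieldAt Y c) (i : Fin n) (V : TC c) :
    dx φ i c.1 (nabla₁ (fun c' => nabla₁ s c' (Y c')) c V) =
      dirDeriv (fun c' => dirDeriv (secComp φ i s) c' (Y c')) c V +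
      dirDeriv (fun c' => connForm φ i c' (Y c') s) c V +
      ∑ j, ∑ k, coordA φ i j k c * dX φ j c V *
        (dirDeriv (secComp φ k s) c (Y c) + connForm φ k c (Y c) s) := by
  have h1 := fun k => mdifferentiableAt_mvfderiv_field (hs.contMDiffAt_secComp hφ hc k) hY.diff
  have h2 := diffFun_connForm hφ hc hs hY
  have h3 := secComp_nabla₁_eventuallyEq hφ hc hs Y
  rw [dx_nabla₁ hφ hc (fun k => (MDifferentiableAt.add (h1 k) (h2 k)).congr_of_eventuallyEq (h3 k)),
    dirDeriv_congr (h3 i), dirDeriv_add (h1 i) (h2 i)]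
  simp only [(h3 _).self_of_nhds]

/-- This is the structure equation R = dω + ω∧ω for ωⁱ_k = Aⁱ_{jk} dxʲ; no derivative of X, Y or s
survives. -/
theorem dx_curvature₁ (hφ : IsCoord φ) (hc : c.1 ∈ φ.source)
    {s : ∀ c : ConnBundle n N, TN c} (hs : SmoothSecAt s c) {X Y : ∀ c : ConnBundle n N, TC c}
    (hX : SmoothFieldAt X c) (hY : SmoothFieldAt Y c) (i : Fin n) :
    dx φ i c.1 (curvature₁ X Y s c) = ∑ j, ∑ k,
      ((dA φ i j k c (X c) * dX φ j c (Y c) - dA φ i j k c (Y c) * dX φ j c (X c)) * secComp φ k s c +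
        coordA φ i j k c * (dX φ j c (X c) * connForm φ k c (Y c) s -
          dX φ j c (Y c) * connForm φ k c (X c) s)) := by
  have hbr : dirDeriv (secComp φ i s) c (VectorField.mlieBracket 𝓘(ℝ, Eu n × Arr n) X Y c) =
      dirDeriv (fun c' => dirDeriv (secComp φ i s) c' (Y c')) c (X c) -
        dirDeriv (fun c' => dirDeriv (secComp φ i s) c' (X c')) c (Y c) :=
    mvfderiv_mlieBracket (hs.contMDiffAt_secComp hφ hc i) hX.diff hY.diff
  rw [curvature₁, map_sub, map_sub, dx_nabla₁_nabla₁ hφ hc hs hY, dx_nabla₁_nabla₁ hφ hc hs hX,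
    dirDeriv_connForm hφ hc hs hY, dirDeriv_connForm hφ hc hs hX,
    dx_nabla₁ hφ hc (hs.diffFun_secComp hφ hc), hbr]
  simp only [dX_mlieBracket hφ hc hX hY]
  -- Here a and b are X(Y sⁱ) and Y(X sⁱ), the only second derivatives of s; the bracket term a − b
  -- removes them.
  have key : ∀ a b p q r u v : ℝ, a + p + q - (b + r + u) - (a - b + v) = p + q - r - u - v := by
    intros
    ring
  rw [key]
  simp only [← Finset.sum_add_distrib, ← Finset.sum_sub_distrib]
  refine Finset.sum_congr rfl fun j _ => Finset.sum_congr rfl fun k _ => ?_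
  ring

/-! ### The torsion in coordinates -/

/-- Coordinate fields are pullbacks of constant fields along φ, constant fields commute, and the
bracket is natural under pullback. -/
theorem mlieBracket_coordField {x : N} (hφ : IsCoord φ) (hx : x ∈ φ.source) (j k : Fin n) :
    VectorField.mlieBracket (𝓡 n) (coordField φ j) (coordField φ k) x = 0 := by
  have : IsManifold (𝓡 n) 2 N := IsManifold.of_le (n := ∞) two_le_infty
  have : IsManifold (𝓡 n) (minSmoothness ℝ 3) N := by
    simp only [minSmoothness_of_isRCLikeNormedField]
    exact IsManifold.of_le (n := ∞) (WithTop.coe_le_coe.2 (le_top : (3 : ℕ∞) ≤ ⊤))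
  have hconst : ∀ k : Fin n, MDifferentiableAt (𝓡 n) (𝓡 n).tangent
      (fun y => (⟨y, (EuclideanSpace.single k (1 : ℝ) : Eu n)⟩ : TangentBundle (𝓡 n) (Eu n)))
      (φ x) := fun k =>
    ((contMDiffAt_vectorSpace_iff_contDiffAt (n := 1)).2 contDiffAt_const).mdifferentiableAt
      one_ne_zero
  have h := VectorField.mpullback_mlieBracket (I := 𝓡 n) (I' := 𝓡 n) (f := φ) (x₀ := x) (n := ∞)
    (V := fun _ => (EuclideanSpace.single j (1 : ℝ) : Eu n))
    (W := fun _ => (EuclideanSpace.single k (1 : ℝ) : Eu n))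
    (hconst j) (hconst k) (contMDiffAt_of_mem_maximalAtlas hφ hx)
    (by simpa only [minSmoothness_of_isRCLikeNormedField] using two_le_infty)
  refine h.symm.trans ?_
  have h0 : VectorField.mlieBracket (𝓡 n) (fun _ : Eu n => (EuclideanSpace.single j (1 : ℝ) : Eu n))
      (fun _ => (EuclideanSpace.single k (1 : ℝ) : Eu n)) = fun _ => (0 : Eu n) := by
    refine (VectorField.mlieBracketWithin_eq_lieBracketWithin (s := univ)).trans ?_
    funext y
    simp [VectorField.lieBracketWithin_eq]
  rw [h0]
  exact map_zero _

/-- The torsion is tensorial, so it may be evaluated on coordinate fields, whose bracket vanishes.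
-/
theorem dx_tauN (hφ : IsCoord φ) (hc : c.1 ∈ φ.source) (i : Fin n) (v w : TN c) :
    dx φ i c.1 (tauN c v w) = ∑ j, ∑ k, (coordA φ i j k c - coordA φ i k j c) *
      dx φ j c.1 v * dx φ k c.1 w := by
  have h : ∀ j k, dx φ i c.1 (c.2.torsion (coordField φ j c.1) (coordField φ k c.1)) =
      coordA φ i j k c - coordA φ i k j c := by
    intro j k
    rw [c.2.torsion_apply (mdiff_coordField hφ hc j) (mdiff_coordField hφ hc k),
      mlieBracket_coordField hφ hc, sub_zero, map_sub]
    rfl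
  change dx φ i c.1 (c.2.torsion v w) = _
  conv_lhs => rw [coord_decomp hφ hc v, coord_decomp hφ hc w]
  simp only [map_sum, map_smul, sum_apply, smul_apply, smul_eq_mul, h, Finset.mul_sum]
  rw [Finset.sum_comm]
  exact Finset.sum_congr rfl fun j _ => Finset.sum_congr rfl fun k _ => by ring

theorem secComp_tauN_eventuallyEq (hφ : IsCoord φ) (hc : c.1 ∈ φ.source)
    (Y Z : ∀ c : ConnBundle n N, TN c) (i : Fin n) :
    secComp φ i (fun c' => tauN c' (Y c') (Z c')) =ᶠ[𝓝 c] fun c' => ∑ j, ∑ k,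
      (coordA φ i j k c' - coordA φ i k j c') * secComp φ j Y c' * secComp φ k Z c' := by
  filter_upwards [eventually_mem_source hc] with c' hc'
  exact dx_tauN hφ hc' i (Y c') (Z c')

/-- The product rule for Tⁱ_{jk} Yʲ Zᵏ gives dTⁱ_{jk} and terms with derivatives of Yʲ and Zᵏ. The
latter cancel against T(∇Y, Z) and T(Y, ∇Z), which leaves only connection terms. -/
theorem dx_nabla₂_tauN (hφ : IsCoord φ) (hc : c.1 ∈ φ.source) {Y Z : ∀ c : ConnBundle n N, TN c}
    (hY : SmoothSecAt Y c) (hZ : SmoothSecAt Z c) (X : TC c) (i : Fin n) :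
    dx φ i c.1 (nabla₂ tauN Y Z c X) = ∑ j, ∑ k,
      ((dA φ i j k c X - dA φ i k j c X) * secComp φ j Y c * secComp φ k Z c +
        coordA φ i j k c * dX φ j c X * secComp φ k (fun c' => tauN c' (Y c') (Z c')) c -
        (coordA φ i j k c - coordA φ i k j c) *
          (connForm φ j c X Y * secComp φ k Z c + secComp φ j Y c * connForm φ k c X Z)) := by
  have hA : ∀ i j k, DiffFun (fun c' => coordA φ i j k c' - coordA φ i k j c') c := fun i j k =>
    MDifferentiableAt.sub (diffFun_coordA hφ hc i j k) (diffFun_coordA hφ hc i k j)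
  have h1 := fun i j k => diffFun_mul (hA i j k) (hY.diffFun_secComp hφ hc j)
  have h2 := fun k => hZ.diffFun_secComp hφ hc k
  have h3 := secComp_tauN_eventuallyEq hφ hc Y Z
  have h4 : dirDeriv (fun c' => ∑ j, ∑ k,
      (coordA φ i j k c' - coordA φ i k j c') * secComp φ j Y c' * secComp φ k Z c') c X = ∑ j, ∑ k,
      ((dA φ i j k c X - dA φ i k j c X) * secComp φ j Y c * secComp φ k Z c +
        (coordA φ i j k c - coordA φ i k j c) * dirDeriv (secComp φ j Y) c X * secComp φ k Z c +
        (coordA φ i j k c - coordA φ i k j c) * secComp φ j Y c * dirDeriv (secComp φ k Z) c X) := by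
    rw [dirDeriv_sum fun j => diffFun_sum fun k => diffFun_mul (h1 i j k) (h2 k)]
    refine Finset.sum_congr rfl fun j _ => ?_
    rw [dirDeriv_sum fun k => diffFun_mul (h1 i j k) (h2 k)]
    refine Finset.sum_congr rfl fun k _ => ?_
    rw [dirDeriv_mul (h1 i j k) (h2 k), dirDeriv_mul (hA i j k) (hY.diffFun_secComp hφ hc j),
      dirDeriv_sub (diffFun_coordA hφ hc i j k) (diffFun_coordA hφ hc i k j), dA, dA]
    ring
  rw [nabla₂, map_sub, map_sub, dx_nabla₁ hφ hc (fun m => (diffFun_sum fun j => diffFun_sum fun k =>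
    diffFun_mul (h1 m j k) (h2 k)).congr_of_eventuallyEq (h3 m)), dirDeriv_congr (h3 i), h4,
    dx_tauN hφ hc, dx_tauN hφ hc]
  simp only [dx_nabla₁ hφ hc (hY.diffFun_secComp hφ hc), dx_nabla₁ hφ hc (hZ.diffFun_secComp hφ hc)]
  simp only [← Finset.sum_add_distrib, ← Finset.sum_sub_distrib]
  refine Finset.sum_congr rfl fun j _ => Finset.sum_congr rfl fun k _ => ?_
  simp only [connForm, secComp]
  ring

end
end
end ConnBdl

/-! ### Contraction identities for coefficient arrays. -/

namespace ConnBdl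

section Algebra

variable {n : ℕ} (g : Fin n → Fin n → Fin n → ℝ) (w : Fin n → Fin n → ℝ) (a : Arr n)
  (x y z : Fin n → ℝ)

theorem sum_rotate (f : Fin n → Fin n → Fin n → ℝ) :
    ∑ j, ∑ k, ∑ l, f j k l = ∑ l, ∑ j, ∑ k, f j k l := by
  rw [Finset.sum_comm (γ := Fin n) (f := fun l j => ∑ k, f j k l)]
  exact Finset.sum_congr rfl fun j _ => Finset.sum_comm

/-- For a fixed upper index h, `g j k l`, `w j k` and `a b d k` stand for γ^h_{jkl}, A^h_{jk} and
Aᵏ_{bd}, and x, y, z for components of vectors. The contraction lemmas bring every term to one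
normal form, a sum over the monomials `x t * y r * z s`, so that coefficients can be compared. -/
theorem sum_contract_form : ∑ j, ∑ k, (∑ l, g j k l * x l) * (y j * z k) =
    ∑ t, ∑ r, ∑ s, g r s t * (x t * y r * z s) := by
  simp only [Finset.sum_mul]
  rw [sum_rotate]
  exact Finset.sum_congr rfl fun t _ => Finset.sum_congr rfl fun r _ =>
    Finset.sum_congr rfl fun s _ => by ring

theorem sum_contract_outer : ∑ j, ∑ k, w j k * (x j * ∑ b, ∑ d, a b d k * y b * z d) =
    ∑ t, ∑ r, ∑ s, (∑ m, w t m * a r s m) * (x t * y r * z s) := by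
  refine Finset.sum_congr rfl fun t _ => ?_
  simp only [Finset.sum_mul, Finset.mul_sum]
  rw [← sum_rotate fun r s m => w t m * (x t * (a r s m * y r * z s))]
  exact Finset.sum_congr rfl fun r _ => Finset.sum_congr rfl fun s _ =>
    Finset.sum_congr rfl fun m _ => by ring

theorem sum_contract_left : ∑ j, ∑ k, w j k * ((∑ b, ∑ d, a b d j * x b * y d) * z k) =
    ∑ t, ∑ r, ∑ s, (∑ m, w m s * a t r m) * (x t * y r * z s) := by
  simp only [Finset.sum_mul, Finset.mul_sum]
  have h : ∀ k, ∑ j, ∑ b, ∑ d, w j k * (a b d j * x b * y d * z k) =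
      ∑ b, ∑ d, ∑ j, w j k * (a b d j * x b * y d * z k) := fun k =>
    (sum_rotate fun b d j => w j k * (a b d j * x b * y d * z k)).symm
  rw [Finset.sum_comm]
  simp only [h]
  rw [← sum_rotate fun b d k => ∑ j, w j k * (a b d j * x b * y d * z k)]
  exact Finset.sum_congr rfl fun t _ => Finset.sum_congr rfl fun r _ =>
    Finset.sum_congr rfl fun s _ => Finset.sum_congr rfl fun m _ => by ring

theorem sum_contract_right : ∑ j, ∑ k, w j k * (y j * ∑ b, ∑ d, a b d k * x b * z d) =
    ∑ t, ∑ r, ∑ s, (∑ m, w r m * a t s m) * (x t * y r * z s) := by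
  rw [sum_contract_outer, Finset.sum_comm]
  exact Finset.sum_congr rfl fun t _ => Finset.sum_congr rfl fun r _ =>
    Finset.sum_congr rfl fun s _ => by ring

/-- Evaluation of a trilinear expression on coordinate vectors isolates a single coefficient. -/
theorem sum_single_mul (E : Fin n → Fin n → Fin n → ℝ) (r s t : Fin n) :
    ∑ r', ∑ s', ∑ t', E r' s' t' * ((if r' = r then (1 : ℝ) else 0) *
      (if s' = s then 1 else 0) * (if t' = t then 1 else 0)) = E r s t := by
  simp

theorem curvature_components (d₁ d₂ : Fin n → Fin n → ℝ) :
    (∑ j, ∑ k, (d₁ j k + ∑ l, g j k l * x l) * (y j * z k)) -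
      (∑ j, ∑ k, (d₂ j k + ∑ l, g j k l * y l) * (x j * z k)) -
      ∑ j, ∑ k, ((d₁ j k * y j - d₂ j k * x j) * z k +
        w j k * (x j * (∑ b, ∑ d, a b d k * y b * z d) -
          y j * (∑ b, ∑ d, a b d k * x b * z d))) =
    ∑ r, ∑ s, ∑ t, (g s t r - g r t s - ∑ m, (w r m * a s t m - w s m * a r t m)) *
      (x r * y s * z t) := by
  have h1 : (∑ j, ∑ k, (d₁ j k + ∑ l, g j k l * x l) * (y j * z k)) -
      (∑ j, ∑ k, (d₂ j k + ∑ l, g j k l * y l) * (x j * z k)) -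
      ∑ j, ∑ k, ((d₁ j k * y j - d₂ j k * x j) * z k +
        w j k * (x j * (∑ b, ∑ d, a b d k * y b * z d) -
          y j * (∑ b, ∑ d, a b d k * x b * z d))) =
      (∑ j, ∑ k, (∑ l, g j k l * x l) * (y j * z k)) -
      (∑ j, ∑ k, (∑ l, g j k l * y l) * (x j * z k)) -
      ((∑ j, ∑ k, w j k * (x j * (∑ b, ∑ d, a b d k * y b * z d))) -
        ∑ j, ∑ k, w j k * (y j * (∑ b, ∑ d, a b d k * x b * z d))) := by
    simp only [← Finset.sum_sub_distrib]
    exact Finset.sum_congr rfl fun j _ => Finset.sum_congr rfl fun k _ => by ring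
  -- In the second contraction the roles of x and y are exchanged, so its two outer sums are swapped
  -- to put the index of x outermost, as in the other terms.
  rw [h1, sum_contract_form, sum_contract_form, sum_contract_outer, sum_contract_right,
    Finset.sum_comm (f := fun t r => ∑ s, g r s t * (y t * x r * z s))]
  simp only [← Finset.sum_sub_distrib]
  refine Finset.sum_congr rfl fun r _ => Finset.sum_congr rfl fun s _ =>
    Finset.sum_congr rfl fun t _ => ?_
  rw [Finset.sum_sub_distrib]
  ring

/-- `d₁` stands for dA^h_{jk}(X). Its alternation occurs both in alt₁₂∘γ_C and in the derivative of
the torsion components, and therefore cancels. -/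
theorem torsion_components (d₁ : Fin n → Fin n → ℝ) :
    (∑ j, ∑ k, (d₁ j k + ∑ l, g j k l * x l) * (y j * z k)) -
      (∑ j, ∑ k, (d₁ j k + ∑ l, g j k l * x l) * (z j * y k)) -
      ∑ j, ∑ k, ((d₁ j k - d₁ k j) * y j * z k +
        w j k * x j * (∑ b, ∑ d, (a b d k - a d b k) * y b * z d) -
        (w j k - w k j) * ((∑ b, ∑ d, a b d j * x b * y d) * z k +
          y j * (∑ b, ∑ d, a b d k * x b * z d))) =
    ∑ r, ∑ s, ∑ t, (g r s t - g s r t - ∑ m, (w t m * (a r s m - a s r m) +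
      a t s m * (w m r - w r m) + a t r m * (w s m - w m s))) * (y r * z s * x t) := by
  -- Renaming the summation indices trades the exchange of the arguments y and z for an exchange of
  -- the lower indices.
  have h0 : ∑ j, ∑ k, (d₁ j k + ∑ l, g j k l * x l) * (z j * y k) =
      ∑ j, ∑ k, (d₁ k j + ∑ l, g k j l * x l) * (y j * z k) := by
    rw [Finset.sum_comm]
    exact Finset.sum_congr rfl fun j _ => Finset.sum_congr rfl fun k _ => by ring
  have h1 : (∑ j, ∑ k, (d₁ j k + ∑ l, g j k l * x l) * (y j * z k)) -
      (∑ j, ∑ k, (d₁ k j + ∑ l, g k j l * x l) * (y j * z k)) -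
      ∑ j, ∑ k, ((d₁ j k - d₁ k j) * y j * z k +
        w j k * x j * (∑ b, ∑ d, (a b d k - a d b k) * y b * z d) -
        (w j k - w k j) * ((∑ b, ∑ d, a b d j * x b * y d) * z k +
          y j * (∑ b, ∑ d, a b d k * x b * z d))) =
      (∑ j, ∑ k, (∑ l, g j k l * x l) * (y j * z k)) -
      (∑ j, ∑ k, (∑ l, g k j l * x l) * (y j * z k)) -
      ((∑ j, ∑ k, w j k * (x j * (∑ b, ∑ d, (a b d k - a d b k) * y b * z d))) -
        (∑ j, ∑ k, (w j k - w k j) * ((∑ b, ∑ d, a b d j * x b * y d) * z k)) -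
        ∑ j, ∑ k, (w j k - w k j) * (y j * (∑ b, ∑ d, a b d k * x b * z d))) := by
    simp only [← Finset.sum_sub_distrib]
    exact Finset.sum_congr rfl fun j _ => Finset.sum_congr rfl fun k _ => by ring
  rw [h0, h1, sum_contract_form, sum_contract_form (fun j k l => g k j l),
    sum_contract_outer w (fun b d k => a b d k - a d b k),
    sum_contract_left (fun j k => w j k - w k j), sum_contract_right (fun j k => w j k - w k j)]
  -- The contraction lemmas put the index t of x outermost, whereas the right-hand side has it
  -- innermost.
  conv_rhs => rw [sum_rotate]
  simp only [← Finset.sum_sub_distrib]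
  refine Finset.sum_congr rfl fun t _ => Finset.sum_congr rfl fun r _ =>
    Finset.sum_congr rfl fun s _ => ?_
  have h2 : ∑ m, (w t m * (a r s m - a s r m) + a t s m * (w m r - w r m) +
      a t r m * (w s m - w m s)) = (∑ m, w t m * (a r s m - a s r m)) -
      (∑ m, (w m s - w s m) * a t r m) - ∑ m, (w r m - w m r) * a t s m := by
    simp only [← Finset.sum_sub_distrib]
    exact Finset.sum_congr rfl fun m _ => by ring
  rw [h2]
  ring

end Algebra

/-! ### The two equivalences at a point of C. -/

section

variable {n : ℕ} {N : Type*} [TopologicalSpace N] [ChartedSpace (Eu n) N] [IsManifold (𝓡 n) ∞ N]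
  {φ : OpenPartialHomeomorph N (Eu n)} {c : ConnBundle n N}

/-- The components of `γ̃_C - R^{∇⁽¹⁾}`. -/
theorem dx_gammaTilde_sub_curvature₁ (γC : EhresmannC n N) (hφ : IsCoord φ) (hc : c.1 ∈ φ.source)
    {X Y : ∀ c : ConnBundle n N, TC c} {s : ∀ c : ConnBundle n N, TN c} (hX : SmoothFieldAt X c)
    (hY : SmoothFieldAt Y c) (hs : SmoothSecAt s c) (h : Fin n) :
    dx φ h c.1 (gammaTilde γC c (X c) (Y c) (s c)) - dx φ h c.1 (curvature₁ X Y s c) =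
      ∑ r, ∑ s', ∑ t, (gammaCoeff γC φ h s' t r c - gammaCoeff γC φ h r t s' c -
        ∑ m, (coordA φ h r m c * coordA φ m s' t c - coordA φ h s' m c * coordA φ m r t c)) *
          (dX φ r c (X c) * dX φ s' c (Y c) * secComp φ t s c) := by
  rw [dx_curvature₁ hφ hc hs hX hY, gammaTilde, LinearMap.sub_apply, map_sub,
    dx_gammaTensor γC hφ hc, dx_gammaTensor γC hφ hc]
  exact curvature_components (fun j k l => gammaCoeff γC φ h j k l c) (fun j k => coordA φ h j k c)
    (fun b d k => coordA φ k b d c) (fun j => dX φ j c (X c)) (fun j => dX φ j c (Y c))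
    (fun k => secComp φ k s c) (fun j k => dA φ h j k c (X c)) (fun j k => dA φ h j k c (Y c))

/-- The components of `alt₁₂ ∘ γ_C - ∇⁽²⁾ τ_N`. -/
theorem dx_alt_gammaTensor_sub_nabla₂ (γC : EhresmannC n N) (hφ : IsCoord φ) (hc : c.1 ∈ φ.source)
    {Y Z : ∀ c : ConnBundle n N, TN c} (hY : SmoothSecAt Y c) (hZ : SmoothSecAt Z c) (X : TC c)
    (h : Fin n) :
    dx φ h c.1 (alt₁₂ (gammaTensor γC c X) (Y c) (Z c)) - dx φ h c.1 (nabla₂ tauN Y Z c X) =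
      ∑ r, ∑ s, ∑ t, (gammaCoeff γC φ h r s t c - gammaCoeff γC φ h s r t c -
        ∑ m, (coordA φ h t m c * (coordA φ m r s c - coordA φ m s r c)
            + coordA φ m t s c * (coordA φ h m r c - coordA φ h r m c)
            + coordA φ m t r c * (coordA φ h s m c - coordA φ h m s c))) *
          (secComp φ r Y c * secComp φ s Z c * dX φ t c X) := by
  rw [dx_nabla₂_tauN hφ hc hY hZ, alt₁₂, LinearMap.sub_apply, LinearMap.sub_apply, map_sub,
    LinearMap.flip_apply, dx_gammaTensor γC hφ hc, dx_gammaTensor γC hφ hc]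
  simp only [(secComp_tauN_eventuallyEq hφ hc Y Z _).self_of_nhds]
  exact torsion_components (fun j k l => gammaCoeff γC φ h j k l c) (fun j k => coordA φ h j k c)
    (fun b d k => coordA φ k b d c) (fun j => dX φ j c X) (fun j => secComp φ j Y c)
    (fun k => secComp φ k Z c) (fun j k => dA φ h j k c X)

theorem secComp_coordField (hφ : IsCoord φ) (hc : c.1 ∈ φ.source) (i k : Fin n) :
    secComp φ i (fun c' : ConnBundle n N => coordField φ k c'.1) c = if i = k then 1 else 0 :=
  dx_coordField hφ hc i k

/-- The difference of the two sides depends only on the values of X, Y, s at c, trilinearly. The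
fields ∂/∂xʳ, ∂/∂xˢ of C and the section ∂/∂xᵗ of p_C^* TN read off the coefficient with indices r,
s, t; conversely, if all coefficients vanish, so do all components of the difference. -/
theorem curvatureEqAt_iff (γC : EhresmannC n N) (hφ : IsCoord φ) (hc : c.1 ∈ φ.source) :
    CurvatureEqAt γC c ↔ ∀ h r s t : Fin n,
      gammaCoeff γC φ h s t r c - gammaCoeff γC φ h r t s c =
        ∑ m, (coordA φ h r m c * coordA φ m s t c - coordA φ h s m c * coordA φ m r t c) := by
  constructor
  · intro H h r s t
    have h1 := H _ _ _ (contMDiffAt_baseField hφ hc r) (contMDiffAt_baseField hφ hc s)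
      (smoothSecAt_coordField hφ hc t)
    have h2 := dx_gammaTilde_sub_curvature₁ γC hφ hc (contMDiffAt_baseField hφ hc r)
      (contMDiffAt_baseField hφ hc s) (smoothSecAt_coordField hφ hc t) h
    simp only [dX_baseField hφ hc, secComp_coordField hφ hc] at h2
    rw [h1, sub_self, sum_single_mul (fun r s t => gammaCoeff γC φ h s t r c -
      gammaCoeff γC φ h r t s c - ∑ m, (coordA φ h r m c * coordA φ m s t c -
        coordA φ h s m c * coordA φ m r t c))] at h2
    exact sub_eq_zero.1 h2.symm
  · intro H X Y s hX hY hs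
    refine coord_ext hφ hc fun h => sub_eq_zero.1 ?_
    rw [dx_gammaTilde_sub_curvature₁ γC hφ hc hX hY hs]
    simp [H]

/-- The same argument, with the tangent vector ∂/∂xᵗ of C at c and the sections ∂/∂xʳ, ∂/∂xˢ of
p_C^* TN as test objects. Vertical X give no further condition, because the dA-components have
cancelled. -/
theorem torsionEqAt_iff (γC : EhresmannC n N) (hφ : IsCoord φ) (hc : c.1 ∈ φ.source) :
    TorsionEqAt γC c ↔ ∀ h r s t : Fin n,
      gammaCoeff γC φ h r s t c - gammaCoeff γC φ h s r t c =
        ∑ m, (coordA φ h t m c * (coordA φ m r s c - coordA φ m s r c)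
            + coordA φ m t s c * (coordA φ h m r c - coordA φ h r m c)
            + coordA φ m t r c * (coordA φ h s m c - coordA φ h m s c)) := by
  constructor
  · intro H h r s t
    have h1 := H (baseField φ t c) _ _ (smoothSecAt_coordField hφ hc r)
      (smoothSecAt_coordField hφ hc s)
    have h2 := dx_alt_gammaTensor_sub_nabla₂ γC hφ hc (smoothSecAt_coordField hφ hc r)
      (smoothSecAt_coordField hφ hc s) (baseField φ t c) h
    simp only [dX_baseField hφ hc, secComp_coordField hφ hc] at h2
    rw [h1, sub_self, sum_single_mul (fun r s t => gammaCoeff γC φ h r s t c -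
      gammaCoeff γC φ h s r t c - ∑ m, (coordA φ h t m c * (coordA φ m r s c - coordA φ m s r c)
            + coordA φ m t s c * (coordA φ h m r c - coordA φ h r m c)
            + coordA φ m t r c * (coordA φ h s m c - coordA φ h m s c)))] at h2
    exact sub_eq_zero.1 h2.symm
  · intro H X Y Z hY hZ
    refine coord_ext hφ hc fun h => sub_eq_zero.1 ?_
    rw [dx_alt_gammaTensor_sub_nabla₂ γC hφ hc hY hZ]
    simp [H]

end
end ConnBdl

theorem mainTheorem10 {n nplus nminus : ℕ} (hsig : n = nplus + nminus)
    {N : Type*} [TopologicalSpace N] [ChartedSpace (ConnBdl.Eu n) N] [IsManifold (𝓡 n) ∞ N]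
    (γ : ConnBdl.EhresmannMC n N nplus) (γC : ConnBdl.EhresmannC n N)
    (hγ : ConnBdl.IsConnComponent γ γC)
    (φ : OpenPartialHomeomorph N (ConnBdl.Eu n)) (hφ : ConnBdl.IsCoord φ)
    (c : ConnBdl.ConnBundle n N) (hc : c.1 ∈ φ.source) :
    (ConnBdl.CurvatureEqAt γC c ↔
      ∀ h r s t : Fin n,
        ConnBdl.gammaCoeff γC φ h s t r c - ConnBdl.gammaCoeff γC φ h r t s c =
          ∑ m : Fin n, (ConnBdl.coordA φ h r m c * ConnBdl.coordA φ m s t c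
            - ConnBdl.coordA φ h s m c * ConnBdl.coordA φ m r t c)) ∧
    (ConnBdl.TorsionEqAt γC c ↔
      ∀ h r s t : Fin n,
        ConnBdl.gammaCoeff γC φ h r s t c - ConnBdl.gammaCoeff γC φ h s r t c =
          ∑ m : Fin n, (ConnBdl.coordA φ h t m c *
              (ConnBdl.coordA φ m r s c - ConnBdl.coordA φ m s r c)
            + ConnBdl.coordA φ m t s c *
              (ConnBdl.coordA φ h m r c - ConnBdl.coordA φ h r m c)
            + ConnBdl.coordA φ m t r c *
              (ConnBdl.coordA φ h s m c - ConnBdl.coordA φ h m s c))) :=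
  ⟨ConnBdl.curvatureEqAt_iff γC hφ hc, ConnBdl.torsionEqAt_iff γC hφ hc⟩
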